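/- Let $(X,\mathscr A,\mu)$ be a $\sigma$-finite measure space, let $\phi\colon X\to X$ and $w\colon X\to\mathbb C$ be $\mathscr A$-measurable, and put $\mu_w(\sigma)=\int_\sigma|w|^2\,d\mu$ for $\sigma\in\mathscr A$. Whenever $\mu_w\circ\phi^{-1}\ll\mu$, let $C_{\phi,w}$ be the weighted composition operator in the complex space $L^2(\mu)$ with domain $\mathcal D(C_{\phi,w})=\{f\in L^2(\mu): w\cdot(f\circ\phi)\in L^2(\mu)\}$ and $C_{\phi,w}f=w\cdot(f\circ\phi)$, and let $\mathsf h_{\phi,w}=d(\mu_w\circ\phi^{-1})/d\mu$. Let $\mathsf E_{\phi,w}(\cdot)$ denote the conditional expectation with respect to the $\sigma$-algebra $\phi^{-1}(\mathscr A)$ and the measure $\mu_w$, and let $\mathsf E_{\phi,w}(f)\circ\phi^{-1}$ be the ($\mu$-a.e. unique) $\mathscr A$-measurable function $e$ on $X$ such that $e=0$ $\mu$-a.e. on $\{\mathsf h_{\phi,w}=0\}$ and $e\circ\phi=\mathsf E_{\phi,w}(f)$ $\mu_w$-a.e. Write $C_\phi=C_{\phi,\mathbf 1}$ and $\mathsf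 E_\phi=\mathsf E_{\phi,\mathbf 1}$, let $M_w$ be the operator of multiplication by $w$ in $L^2(\mu)$ with its maximal domain, and put $f_w=\chi_{\{w\neq0\}}\frac fw$. For an operator $T$ in a Hilbert space with domain $\mathcal D(T)$, kernel $\mathcal N(T)$ and range $\mathcal R(T)$ such that $\mathcal D(T)=\mathcal N(T)\oplus(\mathcal D(T)\cap\mathcal N(T)^\perp)$, let $T^\dagger$ denote its reciprocal (maximal Tseng inverse): the unique operator with domain $\mathcal R(T)\oplus\mathcal R(T)^\perp$ such that $TT^\dagger f=P_{\overline{\mathcal R(T)}}f$ for $f\in\mathcal D(T^\dagger)$, $T^\dagger Tg=P_{\mathcal N(T)^\perp}g$ for $g\in\mathcal D(T)$, and $\mathcal N(T^\dagger)=\mathcal R(T)^\perp$. Products of operators have their natural domains, and $A\subseteq B$ means that $B$ extends $A$. Assume that $\mu_w\circ\phi^{-1}\ll\mu$ and $\mu\circ\phi^{-1}\ll\mu$ and that $C_{\phi,w}$ and $C_\phi$ are densely defined in $L^2(\mu)$. Consider the following conditions: (a$_1$) $C_{\phi,w}^\dagger=C_\phi^\dagger M_w^\dagger$; (a$_2$)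 $C_{\phi,w}^\dagger\subseteq C_\phi^\dagger M_w^\dagger$; (a$_3$) $C_{\phi,w}^\dagger\supseteq C_\phi^\dagger M_w^\dagger$; (b$_1$) for every $f\in\mathcal D(C_{\phi,w}^\dagger)$, $f_w\in L^2(\mu)$ and $\mathsf E_{\phi,w}(f_w)\circ\phi^{-1}=\mathsf E_\phi(f_w)\circ\phi^{-1}$ a.e. $[\mu]$; (b$_2$) for every $f\in L^2((1+|w|^{-2})\,d\mu)$ (where $\frac10=\infty$ and $0\cdot\infty=0$), $\mathsf E_{\phi,w}(f_w)\circ\phi^{-1}=\mathsf E_\phi(f_w)\circ\phi^{-1}$ a.e. $[\mu]$; (c) $|w|^2=\mathsf E_\phi(|w|^2)$ a.e. $[\mu]$ on $\{w\neq0\}$. Then (a$_1$) $\Leftrightarrow$ (a$_2$) $\Leftrightarrow$ (b$_1$) $\Rightarrow$ (c) $\Rightarrow$ (b$_2$) $\Rightarrow$ (a$_3$). -/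

import Mathlib

open MeasureTheory
open scoped ENNReal

noncomputable section

namespace WCO

/-! ### Unbounded operators in a Hilbert space -/

section Operators

variable {H : Type*} [NormedAddCommGroup H] [InnerProductSpace ℂ H]

/-- The kernel of an operator `T` in `H`, as a subspace of `H`. -/
def kernel (T : H →ₗ.[ℂ] H) : Submodule ℂ H :=
  (LinearMap.ker T.toFun).map T.domain.subtype

/-- The range of an operator `T` in `H`. -/
def range (T : H →ₗ.[ℂ] H) : Submodule ℂ H :=
  LinearMap.range T.toFun

/-- The product `S T` of operators in `H`, with its natural domain
`{x ∈ D(T) : T x ∈ D(S)}`. -/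
def prod (S T : H →ₗ.[ℂ] H) : H →ₗ.[ℂ] H where
  domain :=
    { carrier := {x | ∃ hx : x ∈ T.domain, T ⟨x, hx⟩ ∈ S.domain}
      add_mem' := by
        rintro x y ⟨hx, hx'⟩ ⟨hy, hy'⟩
        refine ⟨T.domain.add_mem hx hy, ?_⟩
        have := T.map_add ⟨x, hx⟩ ⟨y, hy⟩
        exact this ▸ S.domain.add_mem hx' hy'
      zero_mem' := by
        refine ⟨T.domain.zero_mem, ?_⟩
        have : T ⟨0, T.domain.zero_mem⟩ = 0 := T.map_zero
        rw [this]
        exact S.domain.zero_mem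
      smul_mem' := by
        rintro c x ⟨hx, hx'⟩
        refine ⟨T.domain.smul_mem c hx, ?_⟩
        have := T.map_smul c ⟨x, hx⟩
        exact this ▸ S.domain.smul_mem c hx' }
  toFun :=
    { toFun := fun x => S ⟨T ⟨x.1, x.2.1⟩, x.2.2⟩
      map_add' := by
        rintro ⟨x, hx, hx'⟩ ⟨y, hy, hy'⟩
        rw [← S.map_add]
        congr 1
        exact Subtype.ext (T.map_add ⟨x, hx⟩ ⟨y, hy⟩)
      map_smul' := by
        rintro c ⟨x, hx, hx'⟩
        rw [RingHom.id_apply, ← S.map_smul]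
        congr 1
        exact Subtype.ext (T.map_smul c ⟨x, hx⟩) }

/-- The graph of the reciprocal of `T`: all pairs `(f, g)` with `g ∈ D(T) ∩ N(T)ᗮ` and
`f - T g ∈ R(T)ᗮ`; that is, `T g + h ↦ g` for `g ∈ D(T) ∩ N(T)ᗮ` and `h ∈ R(T)ᗮ`. -/
def reciprocalGraph (T : H →ₗ.[ℂ] H) : Submodule ℂ (H × H) where
  carrier := {p | p.2 ∈ (kernel T)ᗮ ∧ ∃ hg : p.2 ∈ T.domain, p.1 - T ⟨p.2, hg⟩ ∈ (range T)ᗮ}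
  add_mem' := by
    rintro ⟨f, g⟩ ⟨f', g'⟩ ⟨h1, h2, h3⟩ ⟨h1', h2', h3'⟩
    refine ⟨Submodule.add_mem _ h1 h1', T.domain.add_mem h2 h2', ?_⟩
    have e : T ⟨g + g', T.domain.add_mem h2 h2'⟩ = T ⟨g, h2⟩ + T ⟨g', h2'⟩ :=
      T.map_add ⟨g, h2⟩ ⟨g', h2'⟩
    have := Submodule.add_mem _ h3 h3'
    dsimp only [Prod.mk_add_mk] at this ⊢
    rw [e]
    convert this using 1
    abel
  zero_mem' := by
    refine ⟨Submodule.zero_mem _, T.domain.zero_mem, ?_⟩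
    have e : T ⟨0, T.domain.zero_mem⟩ = 0 := T.map_zero
    dsimp only [Prod.fst_zero, Prod.snd_zero]
    rw [e, sub_zero]
    exact Submodule.zero_mem _
  smul_mem' := by
    rintro c ⟨f, g⟩ ⟨h1, h2, h3⟩
    refine ⟨Submodule.smul_mem _ c h1, T.domain.smul_mem c h2, ?_⟩
    have e : T ⟨c • g, T.domain.smul_mem c h2⟩ = c • T ⟨g, h2⟩ := T.map_smul c ⟨g, h2⟩
    have := Submodule.smul_mem _ c h3
    dsimp only [Prod.smul_mk] at this ⊢
    rw [e, ← smul_sub]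
    exact this

/-- The graph above is the graph of an operator. -/
theorem reciprocalGraph_single_valued (T : H →ₗ.[ℂ] H) :
    ∀ x ∈ reciprocalGraph T, x.1 = 0 → x.2 = 0 := by
  rintro ⟨f, g⟩ ⟨h1, h2, h3⟩ hf
  dsimp only at hf h1 h2 h3 ⊢
  subst hf
  have hr : T ⟨g, h2⟩ ∈ range T := ⟨⟨g, h2⟩, rfl⟩
  have h0 : T ⟨g, h2⟩ = 0 := by
    rw [zero_sub, Submodule.neg_mem_iff] at h3
    exact inner_self_eq_zero.1 (h3 _ hr)
  have hk : g ∈ kernel T := ⟨⟨g, h2⟩, h0, rfl⟩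
  exact inner_self_eq_zero.1 (h1 _ hk)

/-- The reciprocal (maximal Tseng inverse) `T†` of an operator `T` in `H`. -/
def reciprocal (T : H →ₗ.[ℂ] H) : H →ₗ.[ℂ] H :=
  (reciprocalGraph T).toLinearPMap

theorem mem_reciprocal_graph (T : H →ₗ.[ℂ] H) (f g : H) :
    (f, g) ∈ (reciprocal T).graph ↔
      g ∈ (kernel T)ᗮ ∧ ∃ hg : g ∈ T.domain, f - T ⟨g, hg⟩ ∈ (range T)ᗮ := by
  unfold reciprocal
  rw [Submodule.toLinearPMap_graph_eq _ (reciprocalGraph_single_valued T)]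
  rfl

/-- The defining properties of the reciprocal of `T`: `D(T†) = R(T) ⊕ R(T)ᗮ`, `T T† f` is the
projection of `f` onto the closure of `R(T)`, `T† T g` is the projection of `g` onto `N(T)ᗮ`,
and `N(T†) = R(T)ᗮ`. -/
structure IsReciprocal [CompleteSpace H] (T S : H →ₗ.[ℂ] H) : Prop where
  domain_eq : S.domain = range T ⊔ (range T)ᗮ
  left : ∀ f : S.domain, ∃ h : S f ∈ T.domain,
    T ⟨S f, h⟩ = (range T).topologicalClosure.starProjection f
  right : ∀ g : T.domain, ∃ h : T g ∈ S.domain,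
    S ⟨T g, h⟩ = (kernel T)ᗮ.starProjection g
  kernel_eq : kernel S = (range T)ᗮ

/-- If `D(T) = N(T) ⊕ (D(T) ∩ N(T)ᗮ)`, then `reciprocal T` has the defining properties of the
reciprocal. -/
theorem isReciprocal_reciprocal [CompleteSpace H] (T : H →ₗ.[ℂ] H)
    (hT : T.domain = kernel T ⊔ (T.domain ⊓ (kernel T)ᗮ)) : IsReciprocal T (reciprocal T) := by
  have key : ∀ g (hg : g ∈ T.domain), g ∈ (kernel T)ᗮ → ∀ h ∈ (range T)ᗮ,
      ∃ hd : T ⟨g, hg⟩ + h ∈ (reciprocal T).domain, reciprocal T ⟨_, hd⟩ = g := by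
    intro g hg hgk h hh
    have : (T ⟨g, hg⟩ + h, g) ∈ (reciprocal T).graph := by
      rw [mem_reciprocal_graph]
      exact ⟨hgk, hg, by simpa using hh⟩
    obtain ⟨y, hy, hy'⟩ := (LinearPMap.mem_graph_iff _).1 this
    dsimp only at hy hy'
    refine ⟨hy ▸ y.2, Eq.trans ?_ hy'⟩
    congr 1
    exact Subtype.ext hy.symm
  have dec : ∀ g : T.domain, ∃ k, ∃ hk : k ∈ T.domain, k ∈ (kernel T)ᗮ ∧ T g = T ⟨k, hk⟩ ∧
      (kernel T)ᗮ.starProjection (g : H) = k := by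
    intro g
    have hg : (g : H) ∈ kernel T ⊔ (T.domain ⊓ (kernel T)ᗮ) := hT ▸ g.2
    obtain ⟨a, ha, k, ⟨hk, hk'⟩, hak⟩ := Submodule.mem_sup.1 hg
    have ha' := ha
    obtain ⟨a', h0, rfl⟩ := ha'
    have hgs : g = a' + ⟨k, hk⟩ := Subtype.ext hak.symm
    refine ⟨k, hk, hk', ?_, ?_⟩
    · rw [hgs, T.map_add]
      have : T a' = 0 := h0
      rw [this, zero_add]
    · rw [← hak, map_add, Submodule.starProjection_eq_self_iff.2 hk']
      have : (kernel T)ᗮ.starProjection (T.domain.subtype a') = 0 :=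
        (Submodule.starProjection_apply_eq_zero_iff _).2
          ((Submodule.le_orthogonal_orthogonal _) ha)
      rw [this, zero_add]
  have val : ∀ f : (reciprocal T).domain, reciprocal T f ∈ (kernel T)ᗮ ∧
      ∃ hg : reciprocal T f ∈ T.domain, (f : H) - T ⟨reciprocal T f, hg⟩ ∈ (range T)ᗮ :=
    fun f => (mem_reciprocal_graph T _ _).1 (LinearPMap.mem_graph _ f)
  refine ⟨?_, ?_, ?_, ?_⟩
  · apply le_antisymm
    · intro f hf
      obtain ⟨-, h1, h2⟩ := val ⟨f, hf⟩
      exact Submodule.mem_sup.2 ⟨_, ⟨_, rfl⟩, _, h2, by exact add_sub_cancel _ _⟩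
    · intro f hf
      obtain ⟨_, ⟨g, rfl⟩, h, hh, rfl⟩ := Submodule.mem_sup.1 hf
      obtain ⟨k, hk, hk', e, -⟩ := dec g
      have e' : T.toFun g = T ⟨k, hk⟩ := e
      rw [e']
      exact (key k hk hk' h hh).1
  · intro f
    obtain ⟨-, h1, h2⟩ := val f
    refine ⟨h1, ?_⟩
    symm
    apply Submodule.eq_starProjection_of_mem_orthogonal
    · exact (range T).le_topologicalClosure ⟨_, rfl⟩
    · rwa [Submodule.orthogonal_closure]
  · intro g
    obtain ⟨k, hk, hk', e, e'⟩ := dec g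
    obtain ⟨hd, hv⟩ := key k hk hk' 0 (Submodule.zero_mem _)
    rw [e']
    have ee : T g = T ⟨k, hk⟩ + 0 := by rw [e, add_zero]
    refine ⟨ee ▸ hd, Eq.trans ?_ hv⟩
    congr 1
    exact Subtype.ext ee
  · ext f
    constructor
    · rintro ⟨f, h0, rfl⟩
      obtain ⟨-, h1, h2⟩ := val f
      have h0' : reciprocal T f = 0 := h0
      have : T ⟨reciprocal T f, h1⟩ = 0 := by
        rw [← T.map_zero]
        congr 1
        exact Subtype.ext h0'
      rwa [this, sub_zero] at h2
    · intro hf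
      obtain ⟨hd, hv⟩ := key 0 T.domain.zero_mem (Submodule.zero_mem _) f hf
      have e : T ⟨0, T.domain.zero_mem⟩ + f = f := by
        have : T ⟨0, T.domain.zero_mem⟩ = 0 := T.map_zero
        rw [this, zero_add]
      have hd' : f ∈ (reciprocal T).domain := e ▸ hd
      refine ⟨⟨f, hd'⟩, ?_, rfl⟩
      change reciprocal T ⟨f, hd'⟩ = 0
      rw [← hv]
      congr 1
      exact Subtype.ext e.symm

/-- The defining properties determine the reciprocal. -/
theorem IsReciprocal.unique [CompleteSpace H] {T S S' : H →ₗ.[ℂ] H} (hS : IsReciprocal T S)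
    (hS' : IsReciprocal T S') : S = S' := by
  refine LinearPMap.ext (hS.domain_eq.trans hS'.domain_eq.symm) ?_
  rintro f hf hf'
  have hm := hf
  rw [hS.domain_eq] at hm
  obtain ⟨_, ⟨g, rfl⟩, h, hh, rfl⟩ := Submodule.mem_sup.1 hm
  have aux : ∀ {R : H →ₗ.[ℂ] H}, IsReciprocal T R → ∀ hr : T.toFun g + h ∈ R.domain,
      R ⟨T.toFun g + h, hr⟩ = (kernel T)ᗮ.starProjection g := by
    intro R hR hr
    obtain ⟨h1, h2⟩ := hR.right g
    have h3 : h ∈ kernel R := hR.kernel_eq ▸ hh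
    obtain ⟨h', h0, rfl⟩ := h3
    have : (⟨T.toFun g + R.domain.subtype h', hr⟩ : R.domain) = ⟨T g, h1⟩ + h' :=
      Subtype.ext rfl
    rw [this, R.map_add, h2]
    have h0' : R h' = 0 := h0
    rw [h0', add_zero]
  exact (aux hS hf).trans (aux hS' hf').symm

end Operators

/-! ### Weighted composition operators -/

section Weighted

variable {X : Type*} [MeasurableSpace X] {μ : Measure X} {φ : X → X} {w : X → ℂ}

/-- The measure `μ_w(σ) = ∫_σ |w|² dμ`. -/
def weightedMeasure (μ : Measure X) (w : X → ℂ) : Measure X :=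
  μ.withDensity (fun x => ‖w x‖ₑ ^ 2)

/-- The standing assumptions under which `C_{φ,w}` is well-defined: `φ` and `w` are measurable
and `μ_w ∘ φ⁻¹` is absolutely continuous with respect to `μ`. -/
structure WellDefined (μ : Measure X) (φ : X → X) (w : X → ℂ) : Prop where
  measurable_map : Measurable φ
  measurable_weight : Measurable w
  absolutelyContinuous : (weightedMeasure μ w).map φ ≪ μ

/-- Composition with `φ`, followed by multiplication by `w`, respects equality `μ`-a.e. -/
theorem WellDefined.mul_comp_congr (h : WellDefined μ φ w) {f g : X → ℂ} (hfg : f =ᵐ[μ] g) :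
    (fun x => w x * f (φ x)) =ᵐ[μ] fun x => w x * g (φ x) := by
  have h1 : ∀ᵐ y ∂(weightedMeasure μ w).map φ, f y = g y := h.absolutelyContinuous.ae_le hfg
  have h2 := ae_of_ae_map h.measurable_map.aemeasurable h1
  have hm : Measurable fun x => ‖w x‖ₑ ^ 2 := h.measurable_weight.enorm.pow_const 2
  rw [weightedMeasure, ae_withDensity_iff hm] at h2
  filter_upwards [h2] with x hx
  by_cases h0 : w x = 0
  · simp [h0]
  · rw [hx (by simpa using h0)]

/-- The weighted composition operator `C_{φ,w}` in `L²(μ)`: its domain is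
`{f ∈ L²(μ) : w · (f ∘ φ) ∈ L²(μ)}`, and `C_{φ,w} f = w · (f ∘ φ)`. -/
def weightedComp (h : WellDefined μ φ w) : Lp ℂ 2 μ →ₗ.[ℂ] Lp ℂ 2 μ where
  domain :=
    { carrier := {f | MemLp (fun x => w x * f (φ x)) 2 μ}
      add_mem' := by
        intro f g hf hg
        refine (MemLp.add hf hg).ae_eq ?_
        refine Filter.EventuallyEq.trans ?_ (h.mul_comp_congr (Lp.coeFn_add f g)).symm
        exact Filter.Eventually.of_forall fun x => by simp [mul_add]
      zero_mem' := by
        refine (MemLp.zero (ε := ℂ) (p := 2) (μ := μ)).ae_eq ?_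
        refine Filter.EventuallyEq.trans ?_ (h.mul_comp_congr (Lp.coeFn_zero ℂ 2 μ)).symm
        exact Filter.Eventually.of_forall fun x => by simp
      smul_mem' := by
        intro c f hf
        refine (MemLp.const_smul hf c).ae_eq ?_
        refine Filter.EventuallyEq.trans ?_ (h.mul_comp_congr (Lp.coeFn_smul c f)).symm
        exact Filter.Eventually.of_forall fun x => by simp [mul_left_comm] }
  toFun :=
    { toFun := fun f => MemLp.toLp _ f.2
      map_add' := by
        rintro ⟨f, hf⟩ ⟨g, hg⟩
        rw [← MemLp.toLp_add]
        refine (MemLp.toLp_eq_toLp_iff _ _).2 ((h.mul_comp_congr (Lp.coeFn_add f g)).trans ?_)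
        exact Filter.Eventually.of_forall fun x => by simp [mul_add]
      map_smul' := by
        rintro c ⟨f, hf⟩
        rw [RingHom.id_apply, ← MemLp.toLp_const_smul]
        refine (MemLp.toLp_eq_toLp_iff _ _).2 ((h.mul_comp_congr (Lp.coeFn_smul c f)).trans ?_)
        exact Filter.Eventually.of_forall fun x => by simp [mul_left_comm] }

theorem wellDefined_id (hw : Measurable w) : WellDefined μ id w :=
  ⟨measurable_id, hw, by
    rw [Measure.map_id]; exact withDensity_absolutelyContinuous _ _⟩

/-- The operator `M_w` of multiplication by `w` in `L²(μ)`, with domain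
`{f ∈ L²(μ) : w f ∈ L²(μ)}`; it is the weighted composition operator `C_{id,w}`. -/
def mulOp (μ : Measure X) (w : X → ℂ) (hw : Measurable w) : Lp ℂ 2 μ →ₗ.[ℂ] Lp ℂ 2 μ :=
  weightedComp (wellDefined_id (μ := μ) hw)

/-- The Radon-Nikodym derivative `h_{φ,w} = d(μ_w ∘ φ⁻¹)/dμ`. -/
def radonNikodym (μ : Measure X) (φ : X → X) (w : X → ℂ) : X → ℝ≥0∞ :=
  ((weightedMeasure μ w).map φ).rnDeriv μ

/-- The conditional expectation `E_{φ,w}(f)` of a function `f ∈ L²(μ_w)` with respect to the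
`σ`-algebra `φ⁻¹(𝒜)` and the measure `μ_w` (set to `0` when `f ∉ L²(μ_w)`). -/
def condExpW (h : WellDefined μ φ w) (f : X → ℂ) : X → ℂ :=
  open scoped Classical in
  if hf : MemLp f 2 (weightedMeasure μ w) then
    ((condExpL2 ℂ ℂ h.measurable_map.comap_le (hf.toLp f) : Lp ℂ 2 (weightedMeasure μ w)) :
      X → ℂ)
  else 0

/-- The conditional expectation `E_{φ,w}(f)` of a function `f : X → [0,∞]` with respect to the
`σ`-algebra `φ⁻¹(𝒜)` and the measure `μ_w`. -/
def condLExpW (μ : Measure X) (φ : X → X) (w : X → ℂ) (f : X → ℝ≥0∞) : X → ℝ≥0∞ :=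
  condLExp (MeasurableSpace.comap φ inferInstance) (weightedMeasure μ w) f

theorem exists_condExpW_comp_inv [SigmaFinite μ] (h : WellDefined μ φ w) (f : X → ℂ) :
    ∃ e : X → ℂ, Measurable e ∧ (∀ᵐ x ∂μ, radonNikodym μ φ w x = 0 → e x = 0) ∧
      condExpW h f =ᵐ[weightedMeasure μ w] e ∘ φ := by
  have hE : AEStronglyMeasurable[MeasurableSpace.comap φ inferInstance] (condExpW h f)
      (weightedMeasure μ w) := by
    unfold condExpW
    split_ifs with hf
    · exact aestronglyMeasurable_condExpL2 _ _
    · exact aestronglyMeasurable_zero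
  obtain ⟨e, he, hee⟩ := hE.stronglyMeasurable_mk.exists_eq_measurable_comp
  have hr : Measurable (radonNikodym μ φ w) := Measure.measurable_rnDeriv _ _
  have hs : MeasurableSet {x | radonNikodym μ φ w x ≠ 0} :=
    (hr (measurableSet_singleton 0)).compl
  refine ⟨Set.indicator {x | radonNikodym μ φ w x ≠ 0} e, he.measurable.indicator hs,
    Filter.Eventually.of_forall fun x hx => Set.indicator_of_notMem (by simpa using hx) _, ?_⟩
  have hm : Measurable fun x => ‖w x‖ₑ ^ 2 := h.measurable_weight.enorm.pow_const 2
  have : SFinite (weightedMeasure μ w) := by unfold weightedMeasure; infer_instance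
  have hpos : ∀ᵐ y ∂(weightedMeasure μ w).map φ, radonNikodym μ φ w y ≠ 0 := by
    have := Measure.rnDeriv_pos h.absolutelyContinuous
    filter_upwards [this] with y hy using hy.ne'
  filter_upwards [hE.ae_eq_mk, ae_of_ae_map h.measurable_map.aemeasurable hpos] with x hx hx'
  rw [hx, hee, Function.comp_apply, Function.comp_apply, Set.indicator_of_mem]
  exact hx'

/-- The function `E_{φ,w}(f) ∘ φ⁻¹`: the measurable function on `X`, unique up to a `μ`-null set,
that vanishes a.e. on `{h_{φ,w} = 0}` and whose composition with `φ` is `E_{φ,w}(f)` a.e.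
with respect to `μ_w`. -/
def condExpInv [SigmaFinite μ] (h : WellDefined μ φ w) (f : X → ℂ) : X → ℂ :=
  (exists_condExpW_comp_inv h f).choose

/-- The function `f_w = χ_{w ≠ 0} f / w`. -/
def divW (w f : X → ℂ) : X → ℂ :=
  Set.indicator {x | w x ≠ 0} fun x => f x / w x

/-- The measure `(1 + |w|⁻²) dμ`, where `1/0 = ∞`. -/
def onePlusInvMeasure (μ : Measure X) (w : X → ℂ) : Measure X :=
  μ.withDensity fun x => 1 + (‖w x‖ₑ ^ 2)⁻¹

/-- For every `f ∈ D(C_{φ,w}†)`, `f_w ∈ L²(μ)` and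
`E_{φ,w}(f_w) ∘ φ⁻¹ = E_φ(f_w) ∘ φ⁻¹` a.e. with respect to `μ`. -/
def CondB₁ [SigmaFinite μ] (hw : WellDefined μ φ w) (h1 : WellDefined μ φ (fun _ => 1)) : Prop :=
  ∀ f ∈ (reciprocal (weightedComp hw)).domain,
    MemLp (divW w f) 2 μ ∧ condExpInv hw (divW w f) =ᵐ[μ] condExpInv h1 (divW w f)

/-- For every `f ∈ L²((1 + |w|⁻²) dμ)`,
`E_{φ,w}(f_w) ∘ φ⁻¹ = E_φ(f_w) ∘ φ⁻¹` a.e. with respect to `μ`. -/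
def CondB₂ [SigmaFinite μ] (hw : WellDefined μ φ w) (h1 : WellDefined μ φ (fun _ => 1)) : Prop :=
  ∀ f : X → ℂ, MemLp f 2 (onePlusInvMeasure μ w) →
    condExpInv hw (divW w f) =ᵐ[μ] condExpInv h1 (divW w f)

/-- `|w|² = E_φ(|w|²)` a.e. with respect to `μ` on `{w ≠ 0}`. -/
def CondC (μ : Measure X) (φ : X → X) (w : X → ℂ) : Prop :=
  ∀ᵐ x ∂μ, w x ≠ 0 → ‖w x‖ₑ ^ 2 = condLExpW μ φ (fun _ => 1) (fun y => ‖w y‖ₑ ^ 2) x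

end Weighted

end WCO

end

noncomputable section

namespace WCO

/-! ### Integration against `μ_w` and `μ_w ∘ φ⁻¹`; testing the transported conditional expectation
-/

section Weighted

/-! Everything rests on one formula: `C_{φ,w}†` is `f ↦ E_{φ,w}(f_w) ∘ φ⁻¹` on its maximal domain
(`mem_graph_reciprocal_weightedComp`). It holds because `⟨C_{φ,w} u, f⟩` is the integral of
`E_{φ,w}(f_w) ∘ φ⁻¹` times `conj u` against `μ_w ∘ φ⁻¹ = h_{φ,w} μ`, while `N(C_{φ,w})ᗮ` consists of
the functions vanishing on `{h_{φ,w} = 0}`. For `φ = id` the formula gives `M_w† f = f_w`, so `C_φ†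
M_w†` is `f ↦ E_φ(f_w) ∘ φ⁻¹`, restricted to those `f` with `f_w ∈ L²(μ)`. Comparing graphs yields
(a₂) ⇔ (b₁) and (b₂) ⇒ (a₃).

Density of the domains makes both push-forward measures σ-finite, so `ρ = d(μ_w ∘ φ⁻¹)/d(μ ∘ φ⁻¹)`
is finite a.e., and `ρ ∘ φ = E_φ(|w|²)`. Thus (c) says `|w|² = ρ ∘ φ` on `{w ≠ 0}`. If (c) holds and
`K` vanishes on `{w = 0}`, then `∫ K (u ∘ φ) |w|² dμ = ∫ K ((ρ u) ∘ φ) dμ`, which forces the two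
conditional expectations of `K` to agree (`condExpInv_eq_of_weight_eq`). Conversely, if they agree
for truncations of `K = χ_{w ≠ 0} (|w|² - ρ ∘ φ)`, the same identity reads `∫ |K|² = 0`
(`condC_of_condB₁`). Finally (a₂) gives (a₁) because (b₁) ⇒ (c) ⇒ (b₂) ⇒ (a₃) supplies the other
inclusion. -/

theorem mul_divW {X : Type*} {w : X → ℂ} (f : X → ℂ) (x : X) (hx : w x ≠ 0) :
    w x * divW w f x = f x := by
  rw [divW, Set.indicator_of_mem (by exact hx), mul_div_cancel₀ _ hx]

theorem divW_of_eq_zero {X : Type*} {w : X → ℂ} (f : X → ℂ) (x : X) (hx : w x = 0) :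
    divW w f x = 0 :=
  Set.indicator_of_notMem (by simpa using hx) _

variable {X : Type*} [MeasurableSpace X] {μ : Measure X} {φ : X → X} {w : X → ℂ}

/-- The measure `μ_w ∘ φ⁻¹`. -/
abbrev pushMeasure (μ : Measure X) (φ : X → X) (w : X → ℂ) : Measure X :=
  (weightedMeasure μ w).map φ

theorem weightedMeasure_one : weightedMeasure μ (fun _ => (1 : ℂ)) = μ := by
  simp [weightedMeasure]

theorem WellDefined.measurable_density (h : WellDefined μ φ w) :
    Measurable fun x => ‖w x‖ₑ ^ 2 :=
  h.measurable_weight.enorm.pow_const 2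

theorem integral_weightedMeasure (h : WellDefined μ φ w) (g : X → ℂ) :
    ∫ x, g x ∂weightedMeasure μ w = ∫ x, ((‖w x‖ ^ 2 : ℝ) : ℂ) * g x ∂μ := by
  rw [weightedMeasure, integral_withDensity_eq_integral_toReal_smul h.measurable_density]
  · refine integral_congr_ae (Filter.Eventually.of_forall fun x => ?_)
    simp
  · exact Filter.Eventually.of_forall fun x => by simp

theorem integrable_weightedMeasure_iff (h : WellDefined μ φ w) {g : X → ℂ} :
    Integrable g (weightedMeasure μ w) ↔
      Integrable (fun x => ((‖w x‖ ^ 2 : ℝ) : ℂ) * g x) μ := by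
  rw [weightedMeasure, integrable_withDensity_iff_integrable_smul' h.measurable_density
    (Filter.Eventually.of_forall fun x => by simp)]
  refine integrable_congr (Filter.Eventually.of_forall fun x => ?_)
  simp

theorem ae_weightedMeasure_iff (h : WellDefined μ φ w) {p : X → Prop} :
    (∀ᵐ x ∂weightedMeasure μ w, p x) ↔ ∀ᵐ x ∂μ, w x ≠ 0 → p x := by
  rw [weightedMeasure, ae_withDensity_iff h.measurable_density]
  simp

theorem memLp_weightedMeasure_iff (h : WellDefined μ φ w) {g : X → ℂ}
    (hg : AEStronglyMeasurable g μ) :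
    MemLp g 2 (weightedMeasure μ w) ↔ MemLp (fun x => w x * g x) 2 μ := by
  have hac : weightedMeasure μ w ≪ μ := withDensity_absolutelyContinuous _ _
  rw [memLp_two_iff_integrable_sq_norm (hg.mono_ac hac),
    memLp_two_iff_integrable_sq_norm (f := fun x => w x * g x)
      (h.measurable_weight.aestronglyMeasurable.mul hg),
    weightedMeasure, integrable_withDensity_iff_integrable_smul' h.measurable_density
      (Filter.Eventually.of_forall fun x => by simp)]
  refine integrable_congr (Filter.Eventually.of_forall fun x => ?_)
  simp [mul_pow]

theorem aestronglyMeasurable_divW (h : WellDefined μ φ w) {f : X → ℂ} (hf : AEStronglyMeasurable f μ) :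
    AEStronglyMeasurable (divW w f) μ := by
  refine AEStronglyMeasurable.indicator ?_ ?_
  · exact (hf.aemeasurable.div h.measurable_weight.aemeasurable).aestronglyMeasurable
  · exact (h.measurable_weight (measurableSet_singleton 0)).compl

/-- Since `|w f_w| ≤ |f|`, the conditional expectation of `f_w` never falls into the default branch
of `condExpW`, even when `f_w ∉ L²(μ)`. -/
theorem memLp_divW (h : WellDefined μ φ w) {f : X → ℂ} (hf : MemLp f 2 μ) :
    MemLp (divW w f) 2 (weightedMeasure μ w) := by
  rw [memLp_weightedMeasure_iff h (aestronglyMeasurable_divW h hf.1)]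
  refine hf.mono (h.measurable_weight.aestronglyMeasurable.mul (aestronglyMeasurable_divW h hf.1))
    (Filter.Eventually.of_forall fun x => ?_)
  by_cases hx : w x = 0
  · simp [hx]
  · rw [mul_divW f x hx]

/-- Identifies the domain of `C_{φ,w}` with `L²(μ) ∩ L²(μ_w ∘ φ⁻¹)`. -/
theorem memLp_pushMeasure_iff (h : WellDefined μ φ w) {u : X → ℂ} (hu : Measurable u) :
    MemLp u 2 (pushMeasure μ φ w) ↔ MemLp (fun x => w x * u (φ x)) 2 μ := by
  rw [memLp_map_measure_iff hu.aestronglyMeasurable h.measurable_map.aemeasurable,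
    memLp_weightedMeasure_iff h (hu.comp h.measurable_map).aestronglyMeasurable]
  rfl

theorem measurable_radonNikodym : Measurable (radonNikodym μ φ w) :=
  Measure.measurable_rnDeriv _ _

variable [SigmaFinite μ]

theorem sFinite_pushMeasure : SFinite (pushMeasure μ φ w) := by
  unfold pushMeasure weightedMeasure
  infer_instance

theorem withDensity_radonNikodym (h : WellDefined μ φ w) :
    μ.withDensity (radonNikodym μ φ w) = pushMeasure μ φ w := by
  have : SFinite (pushMeasure μ φ w) := sFinite_pushMeasure
  exact Measure.withDensity_rnDeriv_eq _ _ h.absolutelyContinuous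

theorem ae_pushMeasure_iff (h : WellDefined μ φ w) {p : X → Prop} :
    (∀ᵐ x ∂pushMeasure μ φ w, p x) ↔ ∀ᵐ x ∂μ, radonNikodym μ φ w x ≠ 0 → p x := by
  rw [← withDensity_radonNikodym h, ae_withDensity_iff measurable_radonNikodym]

/-- The measure `μ_w ∘ φ⁻¹` has density `h_{φ,w}`, so it sees everything outside `{h_{φ,w} = 0}`,
where both functions vanish. This is the uniqueness of `E_{φ,w}(f) ∘ φ⁻¹`. -/
theorem ae_eq_of_ae_eq_pushMeasure (h : WellDefined μ φ w) {e g : X → ℂ}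
    (he : ∀ᵐ x ∂μ, radonNikodym μ φ w x = 0 → e x = 0)
    (hg : ∀ᵐ x ∂μ, radonNikodym μ φ w x = 0 → g x = 0)
    (heg : e =ᵐ[pushMeasure μ φ w] g) : e =ᵐ[μ] g := by
  filter_upwards [he, hg, (ae_pushMeasure_iff h).1 heg] with x h1 h2 h3
  by_cases hx : radonNikodym μ φ w x = 0
  · rw [h1 hx, h2 hx]
  · exact h3 hx

theorem measurable_condExpInv (h : WellDefined μ φ w) (K : X → ℂ) :
    Measurable (condExpInv h K) :=
  (exists_condExpW_comp_inv h K).choose_spec.1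

theorem condExpInv_eq_zero (h : WellDefined μ φ w) (K : X → ℂ) :
    ∀ᵐ x ∂μ, radonNikodym μ φ w x = 0 → condExpInv h K x = 0 :=
  (exists_condExpW_comp_inv h K).choose_spec.2.1

theorem condExpInv_comp (h : WellDefined μ φ w) (K : X → ℂ) :
    condExpW h K =ᵐ[weightedMeasure μ w] condExpInv h K ∘ φ :=
  (exists_condExpW_comp_inv h K).choose_spec.2.2

theorem memLp_condExpInv (h : WellDefined μ φ w) (K : X → ℂ) :
    MemLp (condExpInv h K) 2 (pushMeasure μ φ w) := by
  rw [memLp_map_measure_iff (measurable_condExpInv h K).aestronglyMeasurable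
    h.measurable_map.aemeasurable]
  refine MemLp.ae_eq (condExpInv_comp h K) ?_
  unfold condExpW
  split_ifs with hf
  · exact Lp.memLp _
  · exact MemLp.zero

/-- The defining property of the conditional expectation, transported along `φ`. -/
theorem integral_mul_comp_eq (h : WellDefined μ φ w) {K : X → ℂ}
    (hK : MemLp K 2 (weightedMeasure μ w)) {u : X → ℂ} (hu : Measurable u)
    (hu2 : MemLp u 2 (pushMeasure μ φ w)) :
    ∫ x, K x * u (φ x) ∂weightedMeasure μ w =
      ∫ x, condExpInv h K x * u x ∂pushMeasure μ φ w := by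
  set m := weightedMeasure μ w with hm
  have hcomp := condExpInv_comp h K
  rw [integral_map (f := fun x => condExpInv h K x * u x) h.measurable_map.aemeasurable
    ((measurable_condExpInv h K).mul hu).aestronglyMeasurable]
  have hu' : MemLp (fun x => starRingEnd ℂ (u (φ x))) 2 m := by
    have := (memLp_map_measure_iff hu.aestronglyMeasurable h.measurable_map.aemeasurable).1 hu2
    exact this.star
  set U : Lp ℂ 2 m := hu'.toLp _ with hU
  have hUmem : U ∈ lpMeas ℂ ℂ (MeasurableSpace.comap φ inferInstance) 2 m := by
    rw [mem_lpMeas_iff_aestronglyMeasurable]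
    refine AEStronglyMeasurable.congr ?_ hu'.coeFn_toLp.symm
    refine Measurable.aestronglyMeasurable ?_
    have h1 : Measurable fun y => starRingEnd ℂ (u y) := Complex.continuous_conj.measurable.comp hu
    exact h1.comp (comap_measurable φ)
  have : Fact (MeasurableSpace.comap φ inferInstance ≤ (inferInstance : MeasurableSpace X)) :=
    ⟨h.measurable_map.comap_le⟩
  -- `U = conj (u ∘ φ)` is `φ⁻¹(𝒜)`-measurable, so the self-adjoint projection fixes it and can be
  -- moved onto `K`.
  have key : inner ℂ U (hK.toLp K) =
      inner ℂ U (condExpL2 ℂ ℂ h.measurable_map.comap_le (hK.toLp K) : Lp ℂ 2 m) := by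
    have := Submodule.inner_starProjection_left_eq_right
      (lpMeas ℂ ℂ (MeasurableSpace.comap φ inferInstance) 2 m) U (hK.toLp K)
    rw [Submodule.starProjection_eq_self_iff.2 hUmem] at this
    exact this
  rw [L2.inner_def, L2.inner_def] at key
  have e1 : ∫ x, K x * u (φ x) ∂m = ∫ x, inner ℂ (U x) (hK.toLp K x) ∂m := by
    refine integral_congr_ae ?_
    filter_upwards [hK.coeFn_toLp, hu'.coeFn_toLp] with x h1 h2
    rw [h1, h2]
    simp
  have e2 : ∫ x, condExpInv h K (φ x) * u (φ x) ∂m = ∫ x, inner ℂ (U x)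
      ((condExpL2 ℂ ℂ h.measurable_map.comap_le (hK.toLp K) : Lp ℂ 2 m) x) ∂m := by
    refine integral_congr_ae ?_
    unfold condExpW at hcomp
    rw [dif_pos hK] at hcomp
    filter_upwards [hcomp, hu'.coeFn_toLp] with x h1 h2
    rw [h1, h2]
    simp
  rw [e1, e2, key]

end Weighted

/-! ### Reduction to bounded pieces of finite measure -/

section Exhaustion

variable {X : Type*} [MeasurableSpace X] {ν : Measure X}

/-- The sets `spanningSets m n ∩ {r ≤ n}` exhaust `Y`. Taking for `r` the norm of a function makes
its truncations square-integrable, hence admissible test functions. -/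
theorem ae_of_forall_bounded_comp {Y : Type*} [MeasurableSpace Y] (φ : X → Y) (m : Measure Y)
    [SigmaFinite m] {r : Y → ℝ} (hr : Measurable r) {p : X → Prop}
    (h : ∀ (n : ℕ) (B : Set Y), MeasurableSet B → m B < ∞ → (∀ y ∈ B, r y ≤ n) →
      ∀ᵐ x ∂ν, φ x ∈ B → p x) : ∀ᵐ x ∂ν, p x := by
  have key : ∀ n : ℕ, ∀ᵐ x ∂ν, φ x ∈ spanningSets m n ∩ {y | r y ≤ n} → p x := fun n =>
    h n _ ((measurableSet_spanningSets m n).inter (hr measurableSet_Iic))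
      ((measure_mono Set.inter_subset_left).trans_lt (measure_spanningSets_lt_top m n))
      fun x hx => hx.2
  filter_upwards [ae_all_iff.2 key] with x hx
  obtain ⟨k, hk⟩ := exists_nat_ge (r (φ x))
  refine hx (max k (spanningSetsIndex m (φ x))) ⟨?_, ?_⟩
  · exact monotone_spanningSets m (le_max_right _ _) (mem_spanningSetsIndex m (φ x))
  · exact hk.trans (by exact_mod_cast le_max_left _ _)

theorem ae_of_forall_bounded (m : Measure X) [SigmaFinite m] {r : X → ℝ} (hr : Measurable r)
    {p : X → Prop}
    (h : ∀ (n : ℕ) (B : Set X), MeasurableSet B → m B < ∞ → (∀ x ∈ B, r x ≤ n) →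
      ∀ᵐ x ∂ν, x ∈ B → p x) : ∀ᵐ x ∂ν, p x :=
  ae_of_forall_bounded_comp id m hr h

theorem ae_eq_zero_of_integral_mul_conj_indicator {d : X → ℂ} {B : Set X}
    (hd : MemLp (B.indicator d) 2 ν)
    (h : ∫ x, d x * B.indicator (fun x => starRingEnd ℂ (d x)) x ∂ν = 0) :
    ∀ᵐ x ∂ν, x ∈ B → d x = 0 := by
  have e : ∀ x, d x * B.indicator (fun x => starRingEnd ℂ (d x)) x =
      ((‖B.indicator d x‖ ^ 2 : ℝ) : ℂ) := by
    intro x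
    by_cases hx : x ∈ B
    · simp [hx, Complex.mul_conj, Complex.normSq_eq_norm_sq]
    · simp [hx]
  simp_rw [e] at h
  rw [integral_complex_ofReal, Complex.ofReal_eq_zero, integral_eq_zero_iff_of_nonneg] at h
  · filter_upwards [h] with x hx hxB
    simpa [hxB] using hx
  · exact fun x => by positivity
  · exact (memLp_two_iff_integrable_sq_norm hd.1).1 hd

theorem memLp_indicator_of_bounded {d : X → ℂ} (hd : Measurable d) {B : Set X}
    (hB : MeasurableSet B) (hνB : ν B < ∞) (C : ℝ) (hC : ∀ x ∈ B, ‖d x‖ ≤ C) :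
    MemLp (B.indicator d) 2 ν := by
  refine (memLp_indicator_const (μ := ν) 2 hB C (Or.inr hνB.ne)).mono
    (hd.indicator hB).aestronglyMeasurable (Filter.Eventually.of_forall fun x => ?_)
  by_cases hx : x ∈ B
  · simpa [hx] using (hC x hx).trans (le_abs_self C)
  · simp [hx]

end Exhaustion

/-! ### The reciprocal of a weighted composition operator -/

section Weighted

variable {X : Type*} [MeasurableSpace X] {μ : Measure X} {φ : X → X} {w : X → ℂ}

theorem mul_comp_eq_zero_iff (h : WellDefined μ φ w) {u : X → ℂ} (hu : Measurable u) :
    (∀ᵐ x ∂μ, w x * u (φ x) = 0) ↔ ∀ᵐ x ∂pushMeasure μ φ w, u x = 0 := by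
  rw [ae_map_iff (p := fun x => u x = 0) h.measurable_map.aemeasurable (hu (measurableSet_singleton 0)),
    ae_weightedMeasure_iff h]
  refine Filter.eventually_congr (Filter.Eventually.of_forall fun x => ?_)
  simp [mul_eq_zero, or_iff_not_imp_left]

theorem pushMeasure_absolutelyContinuous (h : WellDefined μ φ w) : pushMeasure μ φ w ≪ μ :=
  h.absolutelyContinuous

theorem coeFn_weightedComp (h : WellDefined μ φ w) (f : (weightedComp h).domain) :
    weightedComp h f =ᵐ[μ] fun x => w x * (f : Lp ℂ 2 μ) (φ x) :=
  MemLp.coeFn_toLp f.2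

theorem measurable_coeFn (f : Lp ℂ 2 μ) : Measurable f := (Lp.stronglyMeasurable f).measurable

theorem mem_domain_of_ae_eq (h : WellDefined μ φ w) {u : X → ℂ} (hu : Measurable u)
    (hu2 : MemLp u 2 (pushMeasure μ φ w)) {g : Lp ℂ 2 μ} (hg : g =ᵐ[μ] u) :
    g ∈ (weightedComp h).domain :=
  MemLp.ae_eq (h.mul_comp_congr hg).symm ((memLp_pushMeasure_iff h hu).1 hu2)

theorem memLp_pushMeasure_of_mem_domain (h : WellDefined μ φ w) (g : (weightedComp h).domain) :
    MemLp (g : Lp ℂ 2 μ) 2 (pushMeasure μ φ w) :=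
  (memLp_pushMeasure_iff h (measurable_coeFn _)).2 g.2

theorem mem_kernel_iff (h : WellDefined μ φ w) (g : Lp ℂ 2 μ) :
    g ∈ kernel (weightedComp h) ↔ ∀ᵐ x ∂pushMeasure μ φ w, g x = 0 := by
  rw [← mul_comp_eq_zero_iff h (measurable_coeFn g)]
  constructor
  · rintro ⟨g, hg, rfl⟩
    have hg' : weightedComp h g = 0 := hg
    have h1 := coeFn_weightedComp h g
    rw [hg'] at h1
    filter_upwards [h1, Lp.coeFn_zero ℂ 2 μ] with x h2 h3
    rw [h3] at h2
    exact h2.symm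
  · intro hg
    have hd : g ∈ (weightedComp h).domain :=
      MemLp.ae_eq (f := (0 : X → ℂ)) (by filter_upwards [hg] with x hx using hx.symm) MemLp.zero
    refine ⟨⟨g, hd⟩, ?_, rfl⟩
    change weightedComp h ⟨g, hd⟩ = 0
    refine Lp.ext ?_
    filter_upwards [coeFn_weightedComp h ⟨g, hd⟩, Lp.coeFn_zero ℂ 2 μ, hg] with x h1 h2 h3
    rw [h1, h2]
    exact h3

theorem inner_weightedComp_weightedComp (h : WellDefined μ φ w)
    (U G : (weightedComp h).domain) :
    inner ℂ (weightedComp h U) (weightedComp h G) =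
      ∫ x, (G : Lp ℂ 2 μ) x * starRingEnd ℂ ((U : Lp ℂ 2 μ) x) ∂pushMeasure μ φ w := by
  rw [L2.inner_def, integral_map h.measurable_map.aemeasurable
    (f := fun x => (G : Lp ℂ 2 μ) x * starRingEnd ℂ ((U : Lp ℂ 2 μ) x))
    ((measurable_coeFn _).mul (Complex.continuous_conj.measurable.comp
      (measurable_coeFn _))).aestronglyMeasurable, integral_weightedMeasure h]
  refine integral_congr_ae ?_
  filter_upwards [coeFn_weightedComp h U, coeFn_weightedComp h G] with x h1 h2
  rw [h1, h2, ← Complex.normSq_eq_norm_sq, ← Complex.mul_conj]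
  simp only [RCLike.inner_apply, map_mul]
  ring

variable [SigmaFinite μ]

/-- On `{w ≠ 0}` one has `conj w * f = |w|² f_w`, which turns the inner product into an integral
over `μ_w`; elsewhere `C_{φ,w} U` vanishes. -/
theorem inner_weightedComp (h : WellDefined μ φ w) (U : (weightedComp h).domain)
    (f : Lp ℂ 2 μ) :
    inner ℂ (weightedComp h U) f =
      ∫ x, condExpInv h (divW w f) x * starRingEnd ℂ ((U : Lp ℂ 2 μ) x) ∂pushMeasure μ φ w := by
  rw [← integral_mul_comp_eq h (memLp_divW h (Lp.memLp f))
    (u := fun x => starRingEnd ℂ ((U : Lp ℂ 2 μ) x))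
    (Complex.continuous_conj.measurable.comp (measurable_coeFn _))
    (memLp_pushMeasure_of_mem_domain h U).star, L2.inner_def, integral_weightedMeasure h]
  refine integral_congr_ae ?_
  filter_upwards [coeFn_weightedComp h U] with x h1
  rw [h1, ← Complex.normSq_eq_norm_sq, ← Complex.mul_conj]
  by_cases hx : w x = 0
  · simp [hx]
  · simp only [RCLike.inner_apply, map_mul]
    rw [← mul_divW (w := w) (f : X → ℂ) x hx]
    ring

/-- The restriction of `g` to `{h_{φ,w} = 0}` lies in the kernel; orthogonality of `g` to it kills
its norm. -/
theorem eq_zero_of_mem_kernel_orthogonal (h : WellDefined μ φ w) {g : Lp ℂ 2 μ}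
    (hg : g ∈ (kernel (weightedComp h))ᗮ) :
    ∀ᵐ x ∂μ, radonNikodym μ φ w x = 0 → g x = 0 := by
  have hZ : MeasurableSet {x | radonNikodym μ φ w x = 0} :=
    measurable_radonNikodym (measurableSet_singleton 0)
  have hG : MemLp (Set.indicator {x | radonNikodym μ φ w x = 0} g) 2 μ := (Lp.memLp g).indicator hZ
  have hk : hG.toLp _ ∈ kernel (weightedComp h) := by
    rw [mem_kernel_iff, ae_pushMeasure_iff h]
    filter_upwards [hG.coeFn_toLp] with x h1 h2
    rw [h1, Set.indicator_of_notMem (by exact h2)]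
  have h0 := hg _ hk
  rw [L2.inner_def] at h0
  refine ae_eq_zero_of_integral_mul_conj_indicator (B := {x | radonNikodym μ φ w x = 0})
    ((Lp.memLp g).indicator hZ) (Eq.trans ?_ h0)
  refine integral_congr_ae ?_
  filter_upwards [hG.coeFn_toLp] with x h1
  rw [h1]
  by_cases hx : x ∈ {x | radonNikodym μ φ w x = 0}
  · simp only [Set.indicator_of_mem hx, RCLike.inner_apply]
  · simp only [Set.indicator_of_notMem hx, mul_zero, inner_zero_left]

theorem mem_kernel_orthogonal (h : WellDefined μ φ w) {g : Lp ℂ 2 μ}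
    (hg : ∀ᵐ x ∂μ, radonNikodym μ φ w x = 0 → g x = 0) : g ∈ (kernel (weightedComp h))ᗮ := by
  intro k hk
  rw [mem_kernel_iff, ae_pushMeasure_iff h] at hk
  rw [L2.inner_def]
  refine integral_eq_zero_of_ae ?_
  filter_upwards [hk, hg] with x h1 h2
  by_cases hx : radonNikodym μ φ w x = 0
  · simp [h2 hx]
  · simp [h1 hx]

/-- The reciprocal of `C_{φ,w}` is the operator `f ↦ E_{φ,w}(f_w) ∘ φ⁻¹` with maximal domain. -/
theorem mem_graph_reciprocal_weightedComp (h : WellDefined μ φ w) (f g : Lp ℂ 2 μ) :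
    (f, g) ∈ (reciprocal (weightedComp h)).graph ↔ g =ᵐ[μ] condExpInv h (divW w f) := by
  rw [mem_reciprocal_graph]
  set e := condExpInv h (divW w f) with he
  have hem : Measurable e := measurable_condExpInv h _
  have he2 : MemLp e 2 (pushMeasure μ φ w) := memLp_condExpInv h _
  constructor
  · rintro ⟨hg, hd, ho⟩
    have hg2 := memLp_pushMeasure_of_mem_domain h ⟨g, hd⟩
    have hgm : Measurable (g : X → ℂ) := measurable_coeFn g
    set d : X → ℂ := fun x => g x - e x with hdef
    have hdm : Measurable d := hgm.sub hem
    have hd2 : MemLp d 2 (pushMeasure μ φ w) := hg2.sub he2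
    refine ae_eq_of_ae_eq_pushMeasure h (eq_zero_of_mem_kernel_orthogonal h hg)
      (condExpInv_eq_zero h _) ?_
    have : ∀ᵐ x ∂pushMeasure μ φ w, d x = 0 := by
      -- The natural test function is `d` itself, which need not lie in `L²(μ)`; its restriction to
      -- `B` does, and belongs to the domain of `C_{φ,w}`.
      refine ae_of_forall_bounded μ hdm.norm fun n B hB hμB hn => ?_
      refine ae_eq_zero_of_integral_mul_conj_indicator (hd2.indicator hB) ?_
      have hu := memLp_indicator_of_bounded hdm hB hμB n hn
      have hU := mem_domain_of_ae_eq h (hdm.indicator hB) (hd2.indicator hB) hu.coeFn_toLp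
      have h0 := ho _ ⟨⟨_, hU⟩, rfl⟩
      have h1 : inner ℂ (weightedComp h ⟨_, hU⟩) (f - weightedComp h ⟨g, hd⟩) = 0 := h0
      rw [inner_sub_right, inner_weightedComp_weightedComp, inner_weightedComp,
        ← integral_sub, ← neg_eq_zero, ← integral_neg] at h1
      · refine Eq.trans (integral_congr_ae ?_) h1
        filter_upwards [(pushMeasure_absolutelyContinuous h).ae_le hu.coeFn_toLp] with x hx
        have : (hu.toLp _ : X → ℂ) x = _ := hx
        simp only [this]
        by_cases hxB : x ∈ B <;> simp [hxB, d, e]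
        ring
      · exact he2.integrable_mul (memLp_pushMeasure_of_mem_domain h ⟨_, hU⟩).star
      · exact hg2.integrable_mul (memLp_pushMeasure_of_mem_domain h ⟨_, hU⟩).star
    filter_upwards [this] with x hx using sub_eq_zero.1 hx
  · intro hge
    have hd : g ∈ (weightedComp h).domain := mem_domain_of_ae_eq h hem he2 hge
    refine ⟨mem_kernel_orthogonal h ?_, hd, ?_⟩
    · filter_upwards [hge, condExpInv_eq_zero h (divW w f)] with x h1 h2 h3
      rw [h1, he, h2 h3]
    · rintro _ ⟨U, rfl⟩
      change inner ℂ (weightedComp h U) _ = 0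
      rw [inner_sub_right, sub_eq_zero, inner_weightedComp_weightedComp, inner_weightedComp]
      refine integral_congr_ae ?_
      filter_upwards [(pushMeasure_absolutelyContinuous h).ae_le hge] with x hx
      rw [hx]

theorem mem_domain_reciprocal_iff (h : WellDefined μ φ w) (f : Lp ℂ 2 μ) :
    f ∈ (reciprocal (weightedComp h)).domain ↔ MemLp (condExpInv h (divW w f)) 2 μ := by
  constructor
  · intro hf
    have := (mem_graph_reciprocal_weightedComp h _ _).1
      (LinearPMap.mem_graph (reciprocal (weightedComp h)) ⟨f, hf⟩)
    exact MemLp.ae_eq this (Lp.memLp _)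
  · intro hf
    have := (mem_graph_reciprocal_weightedComp h f (hf.toLp _)).2 hf.coeFn_toLp
    exact LinearPMap.mem_domain_of_mem_graph this

end Weighted

/-! ### Graph of a product -/

section Product

variable {H : Type*} [NormedAddCommGroup H] [InnerProductSpace ℂ H]

theorem mem_prod_graph_iff (S T : H →ₗ.[ℂ] H) (f g : H) :
    (f, g) ∈ (prod S T).graph ↔ ∃ k, (f, k) ∈ T.graph ∧ (k, g) ∈ S.graph := by
  constructor
  · intro hfg
    obtain ⟨y, hy, hy'⟩ := (LinearPMap.mem_graph_iff _).1 hfg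
    dsimp only at hy hy'
    subst hy
    refine ⟨T ⟨y, y.2.1⟩, LinearPMap.mem_graph T ⟨y, y.2.1⟩, ?_⟩
    rw [← hy']
    exact LinearPMap.mem_graph S ⟨_, y.2.2⟩
  · rintro ⟨k, hk, hg⟩
    obtain ⟨⟨y, hyd⟩, hy, hy'⟩ := (LinearPMap.mem_graph_iff _).1 hk
    obtain ⟨⟨z, hzd⟩, hz, hz'⟩ := (LinearPMap.mem_graph_iff _).1 hg
    dsimp only at hy hy' hz hz'
    subst hy hz
    have hd : y ∈ (prod S T).domain := ⟨hyd, by rw [hy']; exact hzd⟩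
    refine (LinearPMap.mem_graph_iff _).2 ⟨⟨y, hd⟩, rfl, ?_⟩
    rw [← hz']
    change S ⟨T ⟨y, hyd⟩, _⟩ = _
    congr 1
    exact Subtype.ext hy'

end Product

/-! ### The reciprocal of `M_w`, the product `C_φ† M_w†`, and comparison of graphs -/

section Weighted

variable {X : Type*} [MeasurableSpace X] {μ : Measure X} {φ : X → X} {w : X → ℂ}

theorem divW_one {X : Type*} (K : X → ℂ) : divW (fun _ => 1) K = K := by
  funext x
  simp [divW]

theorem condExpW_congr (h : WellDefined μ φ w) {K L : X → ℂ}
    (hKL : K =ᵐ[weightedMeasure μ w] L) : condExpW h K = condExpW h L := by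
  unfold condExpW
  by_cases hK : MemLp K 2 (weightedMeasure μ w)
  · have hL : MemLp L 2 (weightedMeasure μ w) := hK.ae_eq hKL
    rw [dif_pos hK, dif_pos hL, (MemLp.toLp_eq_toLp_iff hK hL).2 hKL]
  · have hL : ¬ MemLp L 2 (weightedMeasure μ w) := fun hL => hK (hL.ae_eq hKL.symm)
    rw [dif_neg hK, dif_neg hL]

theorem ae_weightedMeasure_of_ae {p : X → Prop} (hp : ∀ᵐ x ∂μ, p x) :
    ∀ᵐ x ∂weightedMeasure μ w, p x :=
  (withDensity_absolutelyContinuous _ _).ae_le hp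

/-- For `φ = id` the σ-algebra `φ⁻¹(𝒜)` is all of `𝒜`, so the projection is the identity. -/
theorem condExpW_id (hw : Measurable w) {K : X → ℂ} (hK : MemLp K 2 (weightedMeasure μ w)) :
    condExpW (wellDefined_id (μ := μ) hw) K =ᵐ[weightedMeasure μ w] K := by
  have h := wellDefined_id (μ := μ) hw
  have : Fact (MeasurableSpace.comap (id : X → X) inferInstance ≤
      (inferInstance : MeasurableSpace X)) := ⟨h.measurable_map.comap_le⟩
  unfold condExpW
  rw [dif_pos hK]
  have hmem : hK.toLp K ∈ lpMeas ℂ ℂ (MeasurableSpace.comap (id : X → X) inferInstance) 2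
      (weightedMeasure μ w) := by
    rw [mem_lpMeas_iff_aestronglyMeasurable, MeasurableSpace.comap_id]
    exact (Lp.memLp _).1
  have : (condExpL2 ℂ ℂ h.measurable_map.comap_le (hK.toLp K) : Lp ℂ 2 (weightedMeasure μ w)) =
      hK.toLp K := Submodule.starProjection_eq_self_iff.2 hmem
  rw [this]
  exact hK.coeFn_toLp

theorem lintegral_enorm_sq_lt_top {g : X → ℂ} (hg : MemLp g 2 μ) : ∫⁻ x, ‖g x‖ₑ ^ 2 ∂μ < ∞ := by
  simpa using
    (eLpNorm_lt_top_iff_lintegral_rpow_enorm_lt_top two_ne_zero ENNReal.ofNat_ne_top).1 hg.2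

/-- On `{w ≠ 0}` the integrand is `|f|² + |f_w|²`. The cut-off is essential, since the density is
infinite on `{w = 0}`. -/
theorem memLp_onePlusInvMeasure (hw : WellDefined μ φ w) {f : X → ℂ} (hf : MemLp f 2 μ)
    (hfw : MemLp (divW w f) 2 μ) :
    MemLp ({x | w x ≠ 0}.indicator f) 2 (onePlusInvMeasure μ w) := by
  have hZ : MeasurableSet {x | w x ≠ 0} :=
    (hw.measurable_weight (measurableSet_singleton 0)).compl
  have hd : Measurable fun x => 1 + (‖w x‖ₑ ^ 2)⁻¹ := hw.measurable_density.inv.const_add 1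
  refine ⟨((hf.1.indicator hZ).mono_ac (withDensity_absolutelyContinuous _ _)), ?_⟩
  rw [eLpNorm_lt_top_iff_lintegral_rpow_enorm_lt_top two_ne_zero ENNReal.ofNat_ne_top,
    onePlusInvMeasure, lintegral_withDensity_eq_lintegral_mul₀ hd.aemeasurable]
  · refine lt_of_le_of_lt ?_ (ENNReal.add_lt_top.2 ⟨lintegral_enorm_sq_lt_top hf, lintegral_enorm_sq_lt_top hfw⟩)
    rw [← lintegral_add_left' (hf.1.enorm.pow_const 2)]
    refine lintegral_mono fun x => ?_
    by_cases hx : w x = 0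
    · simp [hx]
    · simp only [Pi.mul_apply, ENNReal.toReal_ofNat, ENNReal.rpow_ofNat]
      rw [Set.indicator_of_mem (by exact hx), add_mul, one_mul, divW,
        Set.indicator_of_mem (by exact hx), div_eq_mul_inv, enorm_mul, enorm_inv hx, mul_pow,
        ENNReal.inv_pow, mul_comm]
  · simpa using ((hf.1.indicator hZ).enorm.pow_const (2 : ℝ))

theorem memLp_of_memLp_onePlusInvMeasure {f : X → ℂ} (hw : WellDefined μ φ w)
    (hf : MemLp f 2 (onePlusInvMeasure μ w)) : MemLp f 2 μ ∧ MemLp (divW w f) 2 μ := by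
  have hd : Measurable fun x => 1 + (‖w x‖ₑ ^ 2)⁻¹ := hw.measurable_density.inv.const_add 1
  have hle : μ ≤ onePlusInvMeasure μ w := by
    conv_lhs => rw [← withDensity_one (μ := μ)]
    exact withDensity_mono (Filter.Eventually.of_forall fun x => le_self_add)
  have hfμ := hf.mono_measure hle
  refine ⟨hfμ, aestronglyMeasurable_divW hw hfμ.1, ?_⟩
  have h := lintegral_enorm_sq_lt_top hf
  rw [onePlusInvMeasure, lintegral_withDensity_eq_lintegral_mul₀ hd.aemeasurable
    (hfμ.1.enorm.pow_const 2)] at h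
  rw [eLpNorm_lt_top_iff_lintegral_rpow_enorm_lt_top two_ne_zero ENNReal.ofNat_ne_top]
  refine lt_of_le_of_lt (lintegral_mono fun x => ?_) h
  by_cases hx : w x = 0
  · simp [divW_of_eq_zero f x hx]
  · simp only [Pi.mul_apply, ENNReal.toReal_ofNat, ENNReal.rpow_ofNat]
    rw [divW, Set.indicator_of_mem (by exact hx), div_eq_mul_inv, enorm_mul, enorm_inv hx,
      mul_pow, ENNReal.inv_pow, mul_comm]
    gcongr
    exact le_add_self

variable [SigmaFinite μ]

theorem ae_eq_condExpInv (h : WellDefined μ φ w) {K e : X → ℂ} (he : Measurable e)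
    (he0 : ∀ᵐ x ∂μ, radonNikodym μ φ w x = 0 → e x = 0)
    (hKe : condExpW h K =ᵐ[weightedMeasure μ w] e ∘ φ) : e =ᵐ[μ] condExpInv h K := by
  refine ae_eq_of_ae_eq_pushMeasure h he0 (condExpInv_eq_zero h K) ?_
  refine (ae_map_iff h.measurable_map.aemeasurable
    (measurableSet_eq_fun he (measurable_condExpInv h K))).2 ?_
  filter_upwards [hKe, condExpInv_comp h K] with x h1 h2
  exact h1.symm.trans h2

theorem condExpInv_congr (h : WellDefined μ φ w) {K L : X → ℂ}
    (hKL : K =ᵐ[weightedMeasure μ w] L) : condExpInv h K =ᵐ[μ] condExpInv h L :=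
  ae_eq_condExpInv h (measurable_condExpInv h K) (condExpInv_eq_zero h K)
    (condExpW_congr h hKL ▸ condExpInv_comp h K)

theorem radonNikodym_id (hw : Measurable w) :
    radonNikodym μ id w =ᵐ[μ] fun x => ‖w x‖ₑ ^ 2 := by
  unfold radonNikodym weightedMeasure
  rw [Measure.map_id]
  exact Measure.rnDeriv_withDensity μ (hw.enorm.pow_const 2)

/-- Off `{w = 0}` this is `condExpW_id`; on `{w = 0}` both sides vanish, because `h_{id,w} = |w|²`.
-/
theorem condExpInv_id_divW (hw : Measurable w) {f : X → ℂ} (hf : MemLp f 2 μ) :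
    condExpInv (wellDefined_id (μ := μ) hw) (divW w f) =ᵐ[μ] divW w f := by
  have h := wellDefined_id (μ := μ) hw
  have h1 : ∀ᵐ x ∂μ, w x ≠ 0 → condExpInv h (divW w f) x = divW w f x := by
    rw [← ae_weightedMeasure_iff h]
    filter_upwards [condExpInv_comp h (divW w f), condExpW_id hw (memLp_divW h hf)] with x h2 h3
    exact h2.symm.trans h3
  filter_upwards [h1, condExpInv_eq_zero h (divW w f), radonNikodym_id hw] with x h2 h3 h4
  by_cases hx : w x = 0
  · rw [divW_of_eq_zero f x hx, h3 (by rw [h4]; simp [hx])]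
  · exact h2 hx

theorem mem_graph_reciprocal_mulOp (hw : Measurable w) (f g : Lp ℂ 2 μ) :
    (f, g) ∈ (reciprocal (mulOp μ w hw)).graph ↔ g =ᵐ[μ] divW w f := by
  unfold mulOp
  rw [mem_graph_reciprocal_weightedComp]
  have := condExpInv_id_divW (μ := μ) hw (Lp.memLp f)
  exact ⟨fun h => h.trans this, fun h => h.trans this.symm⟩

theorem mem_graph_prod_reciprocal (hw : Measurable w) (h1 : WellDefined μ φ (fun _ => 1))
    (f g : Lp ℂ 2 μ) :
    (f, g) ∈ (prod (reciprocal (weightedComp h1)) (reciprocal (mulOp μ w hw))).graph ↔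
      MemLp (divW w f) 2 μ ∧ g =ᵐ[μ] condExpInv h1 (divW w f) := by
  rw [mem_prod_graph_iff]
  simp_rw [mem_graph_reciprocal_mulOp, mem_graph_reciprocal_weightedComp, divW_one]
  constructor
  · rintro ⟨k, hk, hg⟩
    exact ⟨MemLp.ae_eq hk (Lp.memLp k),
      hg.trans (condExpInv_congr h1 (ae_weightedMeasure_of_ae hk))⟩
  · rintro ⟨hf, hg⟩
    exact ⟨hf.toLp _, hf.coeFn_toLp,
      hg.trans (condExpInv_congr h1 (ae_weightedMeasure_of_ae hf.coeFn_toLp.symm))⟩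

theorem reciprocal_le_prod_iff (hw : WellDefined μ φ w) (h1 : WellDefined μ φ (fun _ => 1)) :
    reciprocal (weightedComp hw) ≤ prod (reciprocal (weightedComp h1))
      (reciprocal (mulOp μ w hw.measurable_weight)) ↔ CondB₁ hw h1 := by
  rw [← LinearPMap.le_graph_iff]
  constructor
  · intro hle f hf
    have hm := (mem_domain_reciprocal_iff hw f).1 hf
    have := hle ((mem_graph_reciprocal_weightedComp hw f (hm.toLp _)).2 hm.coeFn_toLp)
    rw [mem_graph_prod_reciprocal] at this
    exact ⟨this.1, hm.coeFn_toLp.symm.trans this.2⟩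
  · rintro hb ⟨f, g⟩ hfg
    obtain ⟨hb1, hb2⟩ := hb f (LinearPMap.mem_domain_of_mem_graph hfg)
    rw [mem_graph_reciprocal_weightedComp] at hfg
    exact (mem_graph_prod_reciprocal _ h1 f g).2 ⟨hb1, hfg.trans hb2⟩

theorem prod_le_reciprocal (hw : WellDefined μ φ w) (h1 : WellDefined μ φ (fun _ => 1))
    (hb : CondB₂ hw h1) :
    prod (reciprocal (weightedComp h1)) (reciprocal (mulOp μ w hw.measurable_weight)) ≤
      reciprocal (weightedComp hw) := by
  rw [← LinearPMap.le_graph_iff]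
  rintro ⟨f, g⟩ hfg
  obtain ⟨hf, hg⟩ := (mem_graph_prod_reciprocal _ h1 f g).1 hfg
  rw [mem_graph_reciprocal_weightedComp]
  have h2 := hb _ (memLp_onePlusInvMeasure hw (Lp.memLp f) hf)
  -- Values of `f` on `{w = 0}` do not affect `f_w`, so the cut-off needed for (b₂) is harmless.
  have h3 : divW w ({x | w x ≠ 0}.indicator f) = divW w f := by
    funext x
    by_cases hx : w x = 0 <;> simp [divW, hx]
  rw [h3] at h2
  exact hg.trans h2.symm

end Weighted

/-! ### Finiteness of `h_{φ,w}`, the density `ρ`, and condition (c) -/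

section Weighted

variable {X : Type*} [MeasurableSpace X] {μ : Measure X} {φ : X → X} {w : X → ℂ}
theorem sigmaFinite_trim_comap {m : Measure X} (hφ : Measurable φ) [SigmaFinite (m.map φ)] :
    SigmaFinite (m.trim hφ.comap_le) := by
  refine ⟨⟨⟨fun n => φ ⁻¹' spanningSets (m.map φ) n, fun _ => trivial, fun n => ?_, ?_⟩⟩⟩
  · have hs := measurableSet_spanningSets (m.map φ) n
    rw [trim_measurableSet_eq hφ.comap_le ⟨_, hs, rfl⟩, ← Measure.map_apply hφ hs]
    exact measure_spanningSets_lt_top _ n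
  · rw [← Set.preimage_iUnion, iUnion_spanningSets, Set.preimage_univ]

/-- The Radon-Nikodym derivative of `μ_w ∘ φ⁻¹` with respect to `μ ∘ φ⁻¹`. -/
def relDensity (μ : Measure X) (φ : X → X) (w : X → ℂ) : X → ℝ≥0∞ :=
  (pushMeasure μ φ w).rnDeriv (pushMeasure μ φ fun _ => 1)

theorem measurable_relDensity : Measurable (relDensity μ φ w) :=
  Measure.measurable_rnDeriv _ _

theorem pushMeasure_ac_pushMeasure_one (hw : WellDefined μ φ w) :
    pushMeasure μ φ w ≪ pushMeasure μ φ fun _ => 1 := by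
  unfold pushMeasure
  rw [weightedMeasure_one]
  exact (withDensity_absolutelyContinuous _ _).map hw.measurable_map

theorem relDensity_comp_lt_top (hw : WellDefined μ φ w) [SigmaFinite (pushMeasure μ φ w)] :
    ∀ᵐ x ∂μ, relDensity μ φ w (φ x) < ∞ := by
  have : ∀ᵐ x ∂pushMeasure μ φ fun _ => 1, relDensity μ φ w x < ∞ := Measure.rnDeriv_lt_top _ _
  unfold pushMeasure at this
  rw [weightedMeasure_one] at this
  exact ae_of_ae_map hw.measurable_map.aemeasurable this

variable [SigmaFinite μ]

/-- Each `f` in the domain satisfies `∫ |f|² h_{φ,w} dμ < ∞` and so vanishes on `{h_{φ,w} = ∞}`. The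
indicator of a finite-measure piece of that set is then orthogonal to a dense subspace. -/
theorem radonNikodym_ne_top (h : WellDefined μ φ w)
    (hd : Dense ((weightedComp h).domain : Set (Lp ℂ 2 μ))) :
    ∀ᵐ x ∂μ, radonNikodym μ φ w x ≠ ∞ := by
  have hm : Measurable (radonNikodym μ φ w) := measurable_radonNikodym
  have hZ : MeasurableSet {x | radonNikodym μ φ w x = ∞} := hm (measurableSet_singleton ∞)
  have hdom : ∀ f ∈ (weightedComp h).domain,
      ∀ᵐ x ∂μ, radonNikodym μ φ w x = ∞ → (f : X → ℂ) x = 0 := by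
    intro f hf
    have hf2 := memLp_pushMeasure_of_mem_domain h ⟨f, hf⟩
    have h1 := (eLpNorm_lt_top_iff_lintegral_rpow_enorm_lt_top two_ne_zero
      ENNReal.ofNat_ne_top).1 hf2.2
    rw [← withDensity_radonNikodym h, lintegral_withDensity_eq_lintegral_mul _ hm
      ((measurable_coeFn f).enorm.pow_const _)] at h1
    filter_upwards [ae_lt_top (hm.mul ((measurable_coeFn f).enorm.pow_const _)) h1.ne]
      with x hx hx'
    by_contra h0
    simp [hx', h0] at hx
  refine ae_of_forall_bounded μ (measurable_const (a := (0 : ℝ))) fun n B hB hμB _ => ?_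
  have hS := hB.inter hZ
  have hμS : μ (B ∩ {x | radonNikodym μ φ w x = ∞}) ≠ ∞ :=
    ((measure_mono Set.inter_subset_left).trans_lt hμB).ne
  have hcoe := indicatorConstLp_coeFn (p := 2) (hs := hS) (hμs := hμS) (c := (1 : ℂ))
  have h0 : indicatorConstLp 2 hS hμS (1 : ℂ) = 0 := by
    refine hd.eq_zero_of_inner_left ℂ fun f hf => ?_
    rw [L2.inner_def]
    refine integral_eq_zero_of_ae ?_
    filter_upwards [hdom f hf, hcoe]
      with x h2 h3
    rw [h3]
    by_cases hx : x ∈ B ∩ {x | radonNikodym μ φ w x = ∞}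
    · rw [h2 hx.2]
      simp
    · rw [Set.indicator_of_notMem hx]
      simp
  have h4 : indicatorConstLp 2 hS hμS (1 : ℂ) =ᵐ[μ] 0 := by
    rw [h0]
    exact Lp.coeFn_zero ℂ 2 μ
  filter_upwards [h4, hcoe]
    with x h5 h6 h7 h8
  rw [h6, Set.indicator_of_mem (Set.mem_inter h7 h8)] at h5
  simp at h5

theorem sigmaFinite_pushMeasure (h : WellDefined μ φ w)
    (hd : Dense ((weightedComp h).domain : Set (Lp ℂ 2 μ))) :
    SigmaFinite (pushMeasure μ φ w) := by
  rw [← withDensity_radonNikodym h]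
  exact SigmaFinite.withDensity_of_ne_top (radonNikodym_ne_top h hd)

theorem withDensity_relDensity (hw : WellDefined μ φ w)
    [SigmaFinite (pushMeasure μ φ fun _ => 1)] :
    (pushMeasure μ φ fun _ => 1).withDensity (relDensity μ φ w) = pushMeasure μ φ w := by
  have : SFinite (pushMeasure μ φ w) := sFinite_pushMeasure
  exact Measure.withDensity_rnDeriv_eq _ _ (pushMeasure_ac_pushMeasure_one hw)

theorem integral_pushMeasure_eq (hw : WellDefined μ φ w)
    [SigmaFinite (pushMeasure μ φ fun _ => 1)] [SigmaFinite (pushMeasure μ φ w)] (u : X → ℂ) :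
    ∫ x, u x ∂pushMeasure μ φ w =
      ∫ x, ((relDensity μ φ w x).toReal : ℂ) * u x ∂pushMeasure μ φ fun _ => 1 := by
  rw [← withDensity_relDensity hw, integral_withDensity_eq_integral_toReal_smul
    measurable_relDensity (Measure.rnDeriv_lt_top _ _)]
  rfl

/-- Both functions integrate to `μ_w(φ⁻¹(C))` over every `φ⁻¹(C)`, and `ρ ∘ φ` is
`φ⁻¹(𝒜)`-measurable. -/
theorem relDensity_comp_eq_condLExpW (hw : WellDefined μ φ w)
    [SigmaFinite (pushMeasure μ φ fun _ => 1)] :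
    relDensity μ φ w ∘ φ =ᵐ[μ] condLExpW μ φ (fun _ => 1) fun y => ‖w y‖ₑ ^ 2 := by
  have hmap : pushMeasure μ φ (fun _ => 1) = μ.map φ := by
    rw [pushMeasure, weightedMeasure_one]
  have : SigmaFinite (μ.map φ) := hmap ▸ ‹_›
  have : SigmaFinite (μ.trim hw.measurable_map.comap_le) := sigmaFinite_trim_comap hw.measurable_map
  unfold condLExpW
  rw [weightedMeasure_one]
  refine ae_eq_condLExp hw.measurable_map.comap_le μ _
    (measurable_relDensity.comp (comap_measurable φ)) ?_
  rintro _ ⟨C, hC, rfl⟩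
  have h1 := withDensity_relDensity hw
  rw [hmap] at h1
  have h2 : (μ.map φ).withDensity (relDensity μ φ w) C = pushMeasure μ φ w C := by rw [h1]
  rw [withDensity_apply _ hC, setLIntegral_map hC measurable_relDensity hw.measurable_map,
    pushMeasure, Measure.map_apply hw.measurable_map hC, weightedMeasure,
    withDensity_apply _ (hw.measurable_map hC)] at h2
  exact h2

theorem condC_iff (hw : WellDefined μ φ w) [SigmaFinite (pushMeasure μ φ fun _ => 1)] :
    CondC μ φ w ↔ ∀ᵐ x ∂μ, w x ≠ 0 → ‖w x‖ₑ ^ 2 = relDensity μ φ w (φ x) := by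
  unfold CondC
  have h := relDensity_comp_eq_condLExpW hw
  constructor
  · intro hc
    filter_upwards [h, hc] with x h2 h3 h4
    rw [h3 h4]
    exact h2.symm
  · intro hc
    filter_upwards [h, hc] with x h2 h3 h4
    rw [h3 h4]
    exact h2

end Weighted

/-! ### Condition (c) and equality of the two conditional expectations -/

section Weighted

variable {X : Type*} [MeasurableSpace X] {μ : Measure X} {φ : X → X} {w : X → ℂ}

theorem integrable_fun_mul {f g : X → ℂ} (hf : MemLp f 2 μ) (hg : MemLp g 2 μ) :
    Integrable (fun x => f x * g x) μ :=
  hf.integrable_mul hg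

variable [SigmaFinite μ]

theorem ae_eq_condExpInv_of_integral (h : WellDefined μ φ w) {K g : X → ℂ}
    (hK : MemLp K 2 (weightedMeasure μ w)) (hg : Measurable g)
    (hg2 : MemLp g 2 (pushMeasure μ φ w))
    (hg0 : ∀ᵐ x ∂μ, radonNikodym μ φ w x = 0 → g x = 0)
    (hKg : ∀ u : X → ℂ, Measurable u → MemLp u 2 (pushMeasure μ φ w) →
      ∫ x, K x * u (φ x) ∂weightedMeasure μ w = ∫ x, g x * u x ∂pushMeasure μ φ w) :
    condExpInv h K =ᵐ[μ] g := by
  refine ae_eq_of_ae_eq_pushMeasure h (condExpInv_eq_zero h K) hg0 ?_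
  have hem := measurable_condExpInv h K
  have he2 := memLp_condExpInv h K
  set d : X → ℂ := fun x => condExpInv h K x - g x
  have hdm : Measurable d := hem.sub hg
  have hd2 : MemLp d 2 (pushMeasure μ φ w) := he2.sub hg2
  have hd2s : MemLp (fun x => starRingEnd ℂ (d x)) 2 (pushMeasure μ φ w) := hd2.star
  have hu : Measurable fun x => starRingEnd ℂ (d x) := Complex.continuous_conj.measurable.comp hdm
  have h0 : ∀ᵐ x ∂pushMeasure μ φ w, x ∈ Set.univ → d x = 0 := by
    refine ae_eq_zero_of_integral_mul_conj_indicator (by simpa using hd2) ?_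
    have h1 := hKg _ hu hd2.star
    rw [integral_mul_comp_eq h hK hu hd2.star, ← sub_eq_zero,
      ← integral_sub (integrable_fun_mul he2 hd2s) (integrable_fun_mul hg2 hd2s)] at h1
    simpa only [Set.indicator_univ, d, sub_mul] using h1
  filter_upwards [h0] with x hx using sub_eq_zero.1 (hx trivial)

/-- The factor `χ_B ∘ φ` is `φ⁻¹(𝒜)`-measurable and can be pulled out of the conditional
expectation. -/
theorem condExpInv_indicator (h : WellDefined μ φ w) {K : X → ℂ}
    (hK : MemLp K 2 (weightedMeasure μ w)) {B : Set X} (hB : MeasurableSet B) :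
    condExpInv h ((φ ⁻¹' B).indicator K) =ᵐ[μ] B.indicator (condExpInv h K) := by
  refine ae_eq_condExpInv_of_integral h (hK.indicator (h.measurable_map hB))
    ((measurable_condExpInv h K).indicator hB) ((memLp_condExpInv h K).indicator hB) ?_
    fun u hu hu2 => ?_
  · filter_upwards [condExpInv_eq_zero h K] with x hx hx'
    by_cases hxB : x ∈ B <;> simp [hxB, hx hx']
  · have := integral_mul_comp_eq h hK (hu.indicator hB) (hu2.indicator hB)
    convert this using 3 with x x
    · by_cases hxB : φ x ∈ B <;> simp [hxB]
    · by_cases hxB : x ∈ B <;> simp [hxB]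

/-- By `hc`, the weight `|w|²` can be replaced by `ρ ∘ φ` in integrals of `K`. Testing `E_{φ,w}`
with `u` then amounts to testing `E_φ` with `ρ u`. -/
theorem condExpInv_eq_of_weight_eq (hw : WellDefined μ φ w) (h1 : WellDefined μ φ (fun _ => 1))
    [SigmaFinite (pushMeasure μ φ fun _ => 1)] [SigmaFinite (pushMeasure μ φ w)]
    (hc : ∀ᵐ x ∂μ, w x ≠ 0 → ‖w x‖ₑ ^ 2 = relDensity μ φ w (φ x))
    {K : X → ℂ} (hK0 : ∀ x, w x = 0 → K x = 0) (hK : MemLp K 2 μ)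
    (hKw : MemLp K 2 (weightedMeasure μ w)) :
    condExpInv hw K =ᵐ[μ] condExpInv h1 K := by
  have hK1 : MemLp K 2 (weightedMeasure μ fun _ => 1) := by rwa [weightedMeasure_one]
  have hem := measurable_condExpInv hw K
  have he2 := memLp_condExpInv hw K
  have hgm := measurable_condExpInv h1 K
  have hg2 := memLp_condExpInv h1 K
  have hg0 := condExpInv_eq_zero h1 K
  have hg_mul := fun u => integral_mul_comp_eq h1 hK1 (u := u)
  rw [weightedMeasure_one] at hg_mul
  have he_mul := fun u => integral_mul_comp_eq hw hKw (u := u)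
  set e := condExpInv hw K with he
  set g := condExpInv h1 K
  set ρ : X → ℝ := fun x => (relDensity μ φ w x).toReal with hρ
  have hρm : Measurable ρ := measurable_relDensity.ennreal_toReal
  refine ae_eq_of_ae_eq_pushMeasure hw (condExpInv_eq_zero hw K) ?_ ?_
  · set Z := {x | radonNikodym μ φ w x = 0}
    have hZ : MeasurableSet Z := measurable_radonNikodym (measurableSet_singleton 0)
    -- `E_φ(K) ∘ φ⁻¹` is only known to vanish on the smaller set `{h_φ = 0}`. It vanishes on `Z`
    -- too, since `φ` maps almost no point of `{w ≠ 0}` into `Z`, while `K = 0` on `{w = 0}`.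
    have hKZ : ∀ᵐ x ∂μ, K x * Z.indicator (fun x => starRingEnd ℂ (g x)) (φ x) = 0 := by
      have h2 : ∀ᵐ x ∂pushMeasure μ φ w, x ∉ Z := (ae_pushMeasure_iff hw).2
        (Filter.Eventually.of_forall fun x hx => hx)
      have h3 := (ae_weightedMeasure_iff hw).1 (ae_of_ae_map hw.measurable_map.aemeasurable h2)
      filter_upwards [h3] with x hx
      by_cases hx0 : w x = 0
      · simp [hK0 x hx0]
      · simp [Set.indicator_of_notMem (hx hx0)]
    have h4 : ∀ᵐ x ∂pushMeasure μ φ fun _ => 1, x ∈ Z → g x = 0 := by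
      refine ae_eq_zero_of_integral_mul_conj_indicator (hg2.indicator hZ) ?_
      rw [← hg_mul (Z.indicator fun x => starRingEnd ℂ (g x))
        ((Complex.continuous_conj.measurable.comp hgm).indicator hZ)
        (hg2.star.indicator hZ)]
      exact integral_eq_zero_of_ae hKZ
    filter_upwards [(ae_pushMeasure_iff h1).1 h4, hg0] with x h5 h6 h7
    by_cases hx : radonNikodym μ φ (fun _ => 1) x = 0
    · exact h6 hx
    · exact h5 hx h7
  · set d : X → ℂ := fun x => e x - g x
    have hdm : Measurable d := hem.sub hgm
    have : ∀ᵐ x ∂pushMeasure μ φ w, d x = 0 := by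
      -- The sum of measures makes `B` finite for both. Bounding `d`, `g` and `ρ` together makes
      -- `u`, `ρ u` and `g u` admissible.
      refine ae_of_forall_bounded ((pushMeasure μ φ w) + pushMeasure μ φ fun _ => 1)
        (r := fun x => ‖d x‖ + ‖g x‖ + ρ x) ((hdm.norm.add hgm.norm).add hρm)
        fun n B hB hμB hn => ?_
      have hBw : pushMeasure μ φ w B < ∞ := lt_of_le_of_lt (by simp) hμB
      have hB1 : pushMeasure μ φ (fun _ => 1) B < ∞ := lt_of_le_of_lt (by simp) hμB
      have hρ0 : ∀ x, 0 ≤ ρ x := fun x => ENNReal.toReal_nonneg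
      have hdn : ∀ x ∈ B, ‖d x‖ ≤ n := fun x hx => by
        linarith [hn x hx, norm_nonneg (g x), hρ0 x]
      have hgn : ∀ x ∈ B, ‖g x‖ ≤ n := fun x hx => by
        linarith [hn x hx, norm_nonneg (d x), hρ0 x]
      have hρn : ∀ x ∈ B, ρ x ≤ n := fun x hx => by
        linarith [hn x hx, norm_nonneg (d x), norm_nonneg (g x)]
      have hd2 := memLp_indicator_of_bounded (ν := pushMeasure μ φ w) hdm hB hBw n hdn
      have hgw := memLp_indicator_of_bounded (ν := pushMeasure μ φ w) hgm hB hBw n hgn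
      refine ae_eq_zero_of_integral_mul_conj_indicator hd2 ?_
      have hcm : Measurable fun x => starRingEnd ℂ (d x) :=
        Complex.continuous_conj.measurable.comp hdm
      set u := B.indicator fun x => starRingEnd ℂ (d x) with hu
      have hum : Measurable u := hcm.indicator hB
      have hu2 : MemLp u 2 (pushMeasure μ φ w) :=
        memLp_indicator_of_bounded hcm hB hBw n (by simpa using hdn)
      have hv : (fun x => (ρ x : ℂ) * u x) = B.indicator
          (fun x => (ρ x : ℂ) * starRingEnd ℂ (d x)) := by
        funext x
        by_cases hx : x ∈ B <;> simp [hu, hx]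
      have hvm : Measurable fun x => (ρ x : ℂ) * u x :=
        (Complex.measurable_ofReal.comp hρm).mul hum
      have hv2 : MemLp (fun x => (ρ x : ℂ) * u x) 2 (pushMeasure μ φ fun _ => 1) := by
        rw [hv]
        refine memLp_indicator_of_bounded (d := fun x => (ρ x : ℂ) * starRingEnd ℂ (d x))
          ((Complex.measurable_ofReal.comp hρm).mul hcm) hB hB1
          (n * n) fun x hx => ?_
        rw [norm_mul, Complex.norm_real, Real.norm_of_nonneg (hρ0 x), RCLike.norm_conj]
        exact mul_le_mul (hρn x hx) (hdn x hx) (norm_nonneg _) (Nat.cast_nonneg n)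
      have key : ∫ x, e x * u x ∂pushMeasure μ φ w = ∫ x, g x * u x ∂pushMeasure μ φ w := by
        rw [← he_mul u hum hu2, integral_pushMeasure_eq hw, integral_weightedMeasure hw]
        have h2 := hg_mul _ hvm hv2
        refine Eq.trans ?_ (h2.trans (integral_congr_ae (Filter.Eventually.of_forall fun x => ?_)))
        · refine integral_congr_ae ?_
          filter_upwards [hc] with x hx
          by_cases hx0 : w x = 0
          · simp [hK0 x hx0]
          · have : ‖w x‖ ^ 2 = ρ (φ x) := by
              rw [hρ]
              dsimp only
              rw [← hx hx0]
              simp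
            rw [this]
            ring
        · dsimp only [hρ]
          ring
      have hgu : (fun x => g x * u x) = fun x => B.indicator g x * u x := by
        funext x
        by_cases hx : x ∈ B <;> simp [hu, hx]
      rw [← sub_eq_zero, ← integral_sub (integrable_fun_mul he2 hu2)
        (hgu ▸ integrable_fun_mul hgw hu2)] at key
      refine Eq.trans (integral_congr_ae (Filter.Eventually.of_forall fun x => ?_)) key
      exact sub_mul _ _ _
    filter_upwards [this] with x hx using sub_eq_zero.1 hx

theorem condB₂_of_condC (hw : WellDefined μ φ w) (h1 : WellDefined μ φ (fun _ => 1))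
    [SigmaFinite (pushMeasure μ φ fun _ => 1)] [SigmaFinite (pushMeasure μ φ w)]
    (hc : CondC μ φ w) : CondB₂ hw h1 := by
  intro f hf
  obtain ⟨hf, hfw⟩ := memLp_of_memLp_onePlusInvMeasure hw hf
  exact condExpInv_eq_of_weight_eq hw h1 ((condC_iff hw).1 hc) (divW_of_eq_zero f) hfw
    (memLp_divW hw hf)

/-- Under `CondB₁`, cutting off a function `K` with `w K ∈ L²(μ)` along `φ` makes both
conditional expectations of the result equal to the cut-off of `E_{φ,w}(K) ∘ φ⁻¹`. -/
theorem CondB₁.condExpInv_indicator {hw : WellDefined μ φ w} {h1 : WellDefined μ φ (fun _ => 1)}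
    (hb : CondB₁ hw h1) {K : X → ℂ} (hK0 : ∀ x, w x = 0 → K x = 0)
    (hK : MemLp (fun x => w x * K x) 2 μ) (hKw : MemLp K 2 (weightedMeasure μ w))
    {B : Set X} (hB : MeasurableSet B) (hμB : μ B < ∞) {C : ℝ}
    (hC : ∀ x ∈ B, ‖condExpInv hw K x‖ ≤ C) :
    condExpInv h1 ((φ ⁻¹' B).indicator K) =ᵐ[μ] B.indicator (condExpInv hw K) := by
  have hf := hK.indicator (hw.measurable_map hB)
  have hdiv : divW w (hf.toLp _) =ᵐ[μ] (φ ⁻¹' B).indicator K := by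
    filter_upwards [hf.coeFn_toLp] with x hx
    by_cases hx0 : w x = 0
    · rw [divW_of_eq_zero _ x hx0]
      by_cases hxB : x ∈ φ ⁻¹' B
      · rw [Set.indicator_of_mem hxB, hK0 x hx0]
      · rw [Set.indicator_of_notMem hxB]
    · refine mul_left_cancel₀ hx0 ?_
      rw [mul_divW _ x hx0, hx]
      by_cases hxB : x ∈ φ ⁻¹' B
      · rw [Set.indicator_of_mem hxB, Set.indicator_of_mem hxB]
      · rw [Set.indicator_of_notMem hxB, Set.indicator_of_notMem hxB, mul_zero]
  have he := (condExpInv_congr hw (ae_weightedMeasure_of_ae hdiv)).trans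
    (WCO.condExpInv_indicator hw hKw hB)
  -- The cut-off of `E_{φ,w}(K) ∘ φ⁻¹` is bounded on a set of finite measure, hence in `L²(μ)`; this
  -- places the test vector `χ_{φ⁻¹(B)} w K` in the domain of the reciprocal.
  have hd : hf.toLp _ ∈ (reciprocal (weightedComp hw)).domain :=
    (mem_domain_reciprocal_iff hw _).2 (MemLp.ae_eq he.symm
      (memLp_indicator_of_bounded (measurable_condExpInv hw K) hB hμB C hC))
  have h2 := (hb _ hd).2
  exact (condExpInv_congr h1 (ae_weightedMeasure_of_ae hdiv)).symm.trans (h2.symm.trans he)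

theorem condC_of_condB₁ (hw : WellDefined μ φ w) (h1 : WellDefined μ φ (fun _ => 1))
    [SigmaFinite (pushMeasure μ φ fun _ => 1)] [SigmaFinite (pushMeasure μ φ w)]
    (hb : CondB₁ hw h1) : CondC μ φ w := by
  rw [condC_iff hw]
  set ρ : X → ℝ := fun x => (relDensity μ φ w x).toReal with hρ
  have hρm : Measurable ρ := measurable_relDensity.ennreal_toReal
  have hρφ : Measurable fun x => ρ (φ x) := hρm.comp hw.measurable_map
  have hwm := hw.measurable_weight
  have hρ0 : ∀ x, 0 ≤ ρ x := fun x => ENNReal.toReal_nonneg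
  suffices hs : ∀ᵐ x ∂μ, w x ≠ 0 → ((‖w x‖ ^ 2 - ρ (φ x) : ℝ) : ℂ) = 0 by
    filter_upwards [hs, relDensity_comp_lt_top hw] with x hx hx' h0
    have h2 : ‖w x‖ ^ 2 = ρ (φ x) := sub_eq_zero.1 (Complex.ofReal_eq_zero.1 (hx h0))
    rw [← ENNReal.toReal_eq_toReal_iff' (by simp) hx'.ne]
    simpa using h2
  have hw0 : MeasurableSet {x | w x ≠ 0} := (hwm (measurableSet_singleton 0)).compl
  refine ae_of_forall_bounded μ (r := fun x => ‖w x‖ + ρ (φ x)) (hwm.norm.add hρφ)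
    fun n A hA hμA hn => ?_
  have hwn : ∀ x ∈ A, ‖w x‖ ≤ n := fun x hx => by linarith [hn x hx, hρ0 (φ x)]
  have hρn : ∀ x ∈ A, ρ (φ x) ≤ n := fun x hx => by linarith [hn x hx, norm_nonneg (w x)]
  set δ : X → ℂ := fun x => ((‖w x‖ ^ 2 - ρ (φ x) : ℝ) : ℂ) with hδ
  have hδm : Measurable δ := Complex.measurable_ofReal.comp ((hwm.norm.pow_const 2).sub hρφ)
  have hδn : ∀ x ∈ A ∩ {x | w x ≠ 0}, ‖δ x‖ ≤ (n : ℝ) ^ 2 + n := fun x hx => by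
    rw [hδ, Complex.norm_real, Real.norm_eq_abs]
    have h2 := pow_le_pow_left₀ (norm_nonneg (w x)) (hwn x hx.1) 2
    have h3 := hρn x hx.1
    have h4 := hρ0 (φ x)
    have h5 := sq_nonneg ‖w x‖
    rw [abs_le]
    constructor <;> nlinarith
  have hA' := hA.inter hw0
  have hμA' : μ (A ∩ {x | w x ≠ 0}) < ∞ := (measure_mono Set.inter_subset_left).trans_lt hμA
  -- The defect in (c) serves as its own test function, truncated so that both `K` and `w K` lie in
  -- `L²(μ)`.
  set K : X → ℂ := (A ∩ {x | w x ≠ 0}).indicator δ with hKdef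
  have hK2 : MemLp K 2 μ := memLp_indicator_of_bounded hδm hA' hμA' _ hδn
  have hKm : Measurable K := hδm.indicator hA'
  have hwK : MemLp (fun x => w x * K x) 2 μ := by
    have : (fun x => w x * K x) = (A ∩ {x | w x ≠ 0}).indicator fun x => w x * δ x := by
      funext x
      simp only [hKdef]
      by_cases hx : x ∈ A ∩ {x | w x ≠ 0}
      · rw [Set.indicator_of_mem hx, Set.indicator_of_mem hx]
      · rw [Set.indicator_of_notMem hx, Set.indicator_of_notMem hx, mul_zero]
    rw [this]
    refine memLp_indicator_of_bounded (d := fun x => w x * δ x) (hwm.mul hδm) hA' hμA'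
      (n * ((n : ℝ) ^ 2 + n)) fun x hx => ?_
    rw [norm_mul]
    exact mul_le_mul (hwn x hx.1) (hδn x hx) (norm_nonneg _) (Nat.cast_nonneg n)
  have hKw : MemLp K 2 (weightedMeasure μ w) :=
    (memLp_weightedMeasure_iff hw hKm.aestronglyMeasurable).2 hwK
  have hK0 : ∀ x, w x = 0 → K x = 0 := fun x hx => Set.indicator_of_notMem (fun h => h.2 hx) _
  have hem := measurable_condExpInv hw K
  suffices hs : ∀ᵐ x ∂μ, K x = 0 by
    filter_upwards [hs] with x hx hxA hx0
    rw [hKdef, Set.indicator_of_mem (Set.mem_inter hxA hx0)] at hx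
    exact hx
  -- This second truncation is by sets `φ⁻¹(B)`, as only these commute with the conditional
  -- expectations.
  refine ae_of_forall_bounded_comp φ (μ + pushMeasure μ φ w + pushMeasure μ φ fun _ => 1)
    (r := fun x => ‖condExpInv hw K x‖ + ρ x) (hem.norm.add hρm) fun m B hB hμB hm => ?_
  have hBμ : μ B < ∞ := lt_of_le_of_lt (by simp [add_assoc]) hμB
  have hBw : pushMeasure μ φ w B < ∞ := by
    refine lt_of_le_of_lt ?_ hμB
    rw [Measure.add_apply, Measure.add_apply]
    exact le_add_right le_add_self
  have hB1 : pushMeasure μ φ (fun _ => 1) B < ∞ := lt_of_le_of_lt (by simp) hμB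
  have hen : ∀ x ∈ B, ‖condExpInv hw K x‖ ≤ m := fun x hx => by linarith [hm x hx, hρ0 x]
  have hρn' : ∀ x ∈ B, ρ x ≤ m := fun x hx => by
    linarith [hm x hx, norm_nonneg (condExpInv hw K x)]
  have hD := hw.measurable_map hB
  set L : X → ℂ := (φ ⁻¹' B).indicator K with hL
  have hLw : MemLp L 2 (weightedMeasure μ w) := hKw.indicator hD
  have hLμ : MemLp L 2 μ := hK2.indicator hD
  have hL1 : MemLp L 2 (weightedMeasure μ fun _ => 1) := by rwa [weightedMeasure_one]
  have hLe : condExpInv hw L =ᵐ[μ] condExpInv h1 L :=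
    (WCO.condExpInv_indicator hw hKw hB).trans
      (hb.condExpInv_indicator hK0 hwK hKw hB hBμ hen).symm
  set u : X → ℂ := B.indicator fun _ => 1 with hu
  set v : X → ℂ := B.indicator fun x => (ρ x : ℂ) with hv
  have hum : Measurable u := measurable_const.indicator hB
  have hρc : Measurable fun x => (ρ x : ℂ) := Complex.measurable_ofReal.comp hρm
  have hvm : Measurable v := hρc.indicator hB
  have hu2 : MemLp u 2 (pushMeasure μ φ w) :=
    memLp_indicator_of_bounded measurable_const hB hBw 1 (by simp)
  have hv2 : MemLp v 2 (pushMeasure μ φ fun _ => 1) :=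
    memLp_indicator_of_bounded hρc hB hB1 m fun x hx => by
      simpa [abs_of_nonneg (hρ0 x)] using hρn' x hx
  -- The left side tests `E_{φ,w}(L)` with `χ_B`, the right side tests `E_φ(L)` with `ρ χ_B`; these
  -- agree because `ρ` converts `μ ∘ φ⁻¹` into `μ_w ∘ φ⁻¹`.
  have key : ∫ x, L x * u (φ x) ∂weightedMeasure μ w = ∫ x, L x * v (φ x) ∂μ := by
    have h2 := integral_mul_comp_eq h1 hL1 hvm hv2
    rw [weightedMeasure_one] at h2
    rw [integral_mul_comp_eq hw hLw hum hu2, h2, integral_pushMeasure_eq hw]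
    refine integral_congr_ae ?_
    filter_upwards [(pushMeasure_absolutelyContinuous h1).ae_le hLe] with x hx
    have hx' : condExpInv hw L x = condExpInv h1 L x := hx
    rw [hx']
    by_cases hxB : x ∈ B
    · simp only [hu, hv, Set.indicator_of_mem hxB, hρ]
      ring
    · simp only [hu, hv, Set.indicator_of_notMem hxB, mul_zero]
  have hi1 : Integrable (fun x => L x * u (φ x)) (weightedMeasure μ w) :=
    hLw.integrable_mul ((memLp_map_measure_iff hum.aestronglyMeasurable
      hw.measurable_map.aemeasurable).1 hu2)
  have hi2 : Integrable (fun x => L x * v (φ x)) μ := by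
    have := (memLp_map_measure_iff hvm.aestronglyMeasurable
      hw.measurable_map.aemeasurable).1 hv2
    rw [weightedMeasure_one] at this
    exact hLμ.integrable_mul this
  rw [integral_weightedMeasure hw, ← sub_eq_zero,
    ← integral_sub ((integrable_weightedMeasure_iff hw).1 hi1) hi2] at key
  -- The difference of the two sides of `key` is `∫ L (|w|² - ρ ∘ φ) dμ = ∫ |L|² dμ`.
  refine ae_eq_zero_of_integral_mul_conj_indicator (B := φ ⁻¹' B) hLμ (Eq.trans ?_ key)
  refine integral_congr_ae (Filter.Eventually.of_forall fun x => ?_)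
  dsimp only
  by_cases hxB : φ x ∈ B
  · have e1 : u (φ x) = 1 := Set.indicator_of_mem hxB _
    have e2 : v (φ x) = ρ (φ x) := Set.indicator_of_mem hxB _
    have e3 : L x = K x := Set.indicator_of_mem (by exact hxB) _
    rw [e1, e2, e3, Set.indicator_of_mem (by exact hxB)]
    by_cases hxA : x ∈ A ∩ {x | w x ≠ 0}
    · have e4 : K x = ((‖w x‖ ^ 2 - ρ (φ x) : ℝ) : ℂ) := Set.indicator_of_mem hxA _
      rw [e4, Complex.conj_ofReal]
      push_cast
      ring
    · have e4 : K x = 0 := Set.indicator_of_notMem hxA _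
      simp [e4]
  · have e3 : L x = 0 := Set.indicator_of_notMem (by exact hxB) _
    rw [e3, Set.indicator_of_notMem (by exact hxB)]
    simp

end Weighted

end WCO

end

/-! ### The main theorem -/

theorem theorem20 {X : Type*} [MeasurableSpace X] (μ : Measure X) [SigmaFinite μ]
    (φ : X → X) (w : X → ℂ)
    (hw : WCO.WellDefined μ φ w) (h1 : WCO.WellDefined μ φ (fun _ => 1))
    (hw_dense : Dense ((WCO.weightedComp hw).domain : Set (Lp ℂ 2 μ)))
    (h1_dense : Dense ((WCO.weightedComp h1).domain : Set (Lp ℂ 2 μ))) :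
    (WCO.reciprocal (WCO.weightedComp hw) =
        WCO.prod (WCO.reciprocal (WCO.weightedComp h1))
          (WCO.reciprocal (WCO.mulOp μ w hw.measurable_weight)) ↔
      WCO.reciprocal (WCO.weightedComp hw) ≤
        WCO.prod (WCO.reciprocal (WCO.weightedComp h1))
          (WCO.reciprocal (WCO.mulOp μ w hw.measurable_weight))) ∧
    (WCO.reciprocal (WCO.weightedComp hw) ≤
        WCO.prod (WCO.reciprocal (WCO.weightedComp h1))
          (WCO.reciprocal (WCO.mulOp μ w hw.measurable_weight)) ↔
      WCO.CondB₁ hw h1) ∧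
    (WCO.CondB₁ hw h1 → WCO.CondC μ φ w) ∧
    (WCO.CondC μ φ w → WCO.CondB₂ hw h1) ∧
    (WCO.CondB₂ hw h1 →
      WCO.prod (WCO.reciprocal (WCO.weightedComp h1))
          (WCO.reciprocal (WCO.mulOp μ w hw.measurable_weight)) ≤
        WCO.reciprocal (WCO.weightedComp hw)) := by
  have := WCO.sigmaFinite_pushMeasure hw hw_dense
  have := WCO.sigmaFinite_pushMeasure h1 h1_dense
  refine ⟨⟨fun h => h.le, fun h => le_antisymm h ?_⟩, WCO.reciprocal_le_prod_iff hw h1,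
    WCO.condC_of_condB₁ hw h1, WCO.condB₂_of_condC hw h1, WCO.prod_le_reciprocal hw h1⟩
  exact WCO.prod_le_reciprocal hw h1 (WCO.condB₂_of_condC hw h1
    (WCO.condC_of_condB₁ hw h1 ((WCO.reciprocal_le_prod_iff hw h1).1 h)))
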